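/- **Setting.** Let $\mathcal G$ be a finite directed acyclic graph on nodes $1,\dots,N$. Write $\mathrm{des}(i)$ (resp. $\mathrm{anc}(i)$) for the set of descendants (resp. ancestors) of node $i$, including $i$ itself. Consider the plant $\dot x = Ax+Bu$ with real matrices and with state $x=(x_1,\dots,x_N)$ and input $u=(u_1,\dots,u_N)$ partitioned according to the nodes, where the block $A_{ij}$ vanishes unless $i\in\mathrm{des}(j)$. Let $Q\succeq 0$ and $R\succ 0$ be symmetric real cost matrices for the cost $\int_0^\infty (x^{\mathsf T}Qx+u^{\mathsf T}Ru)\,dt$. Assume that $(A_{ii},B_{ii})$ is stabilizable for every $i$ and that $(Q,A)$ is detectable. Assume moreover that $B$ and $R$ are block-diagonal, with block sizes corresponding to the partitions of $x$ and $u$, and write $R_i$ for the $i$-th diagonal block of $R$. For a set $S$ of nodes, a subscript $S$ denotes the submatrix of the block rows and columns in $S$. Let $F_i=-R_{\mathrm{des}(i)}^{-1}B_{\mathrm{des}(i)}^{\mathsf T}X_i$ be the LQR-optimal gain for $(A_{\mathrm{des}(i)},B_{\mathrm{des}(i)},Q_{\mathrm{des}(i)},R_{\mathrm{des}(i)})$,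 where $X_i\succeq0$ is the stabilizing solution of the associated algebraic Riccati equation. The optimal decentralized LQR controller is the following LTI system from $x$ to $u$. Its memory consists of, for each node $j$, the blocks $(\xi_j)_k$ with $k\in\mathrm{des}(j)\setminus\{j\}$ of a vector $\xi_j$ whose blocks are indexed by $\mathrm{des}(j)$; the remaining block is $(\xi_j)_j = x_j-\sum_{k\in\mathrm{anc}(j)\setminus\{j\}}(\xi_k)_j$. The memory evolves according to the corresponding blocks of $\dot\xi_j=(A_{\mathrm{des}(j)}+B_{\mathrm{des}(j)}F_j)\xi_j$, and the output is $u_i=\sum_{j\in\mathrm{anc}(i)}(F_j\xi_j)_i$. Let $L_{\mathrm{dec}}$, the optimal loop gain, be the cascade of the plant (from $u$ to $x$) followed by this controller (from $x$ to $u$). **Theorem.** Let $\Delta_1,\dots,\Delta_N$ be stable finite-dimensional LTI systems (proper rational transfer matrices with all poles in the open left half-plane; real or complex coefficients), where $\Delta_i$ is square of the size of $u_i$, and let $\Delta_{\mathrm{dec}}=\mathrm{diag}\{\Delta_i\}$. If $$\Delta_i(j\omega)^*R_i+R_i\Delta_i(j\omega)\succ R_i\qquad\text{for all } i=1,\dots,N\text{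 and all }\omega\in\mathbb R,$$ then the feedback interconnection in which the output of $\Delta_{\mathrm{dec}}$ is the input of $L_{\mathrm{dec}}$ and the output of $L_{\mathrm{dec}}$ is the input of $\Delta_{\mathrm{dec}}$ (positive feedback, so that $\Delta_{\mathrm{dec}}=I$ is the nominal loop) is well-posed and internally stable; that is, the loop signals are uniquely determined by the states of the plant, the controller and the perturbations, and the state matrix of the interconnection is Hurwitz. (The state of each $\Delta_i$ is that of any state-space realization of it with Hurwitz state matrix.) -/

import Mathlib

open scoped ComplexOrder Matrix

noncomputable section

namespace DecLQR

/-! ### Linear algebra and classical LQR -/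

/-- The complexification of a real matrix. -/
abbrev toC {α β : Type*} (M : Matrix α β ℝ) : Matrix α β ℂ := M.map Complex.ofReal

/-- A matrix is Hurwitz if all its eigenvalues lie in the open left half-plane. -/
def IsHurwitz {σ : Type*} [Fintype σ] [DecidableEq σ] (M : Matrix σ σ ℂ) : Prop :=
  ∀ z ∈ spectrum ℂ M, z.re < 0

section LQR

variable {σ μ ρ : Type*} [Fintype σ] [DecidableEq σ] [Fintype μ] [DecidableEq μ] [Fintype ρ]

/-- `(A, B)` is stabilizable. -/
def Stabilizable (A : Matrix σ σ ℝ) (B : Matrix σ μ ℝ) : Prop :=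
  ∃ F : Matrix μ σ ℝ, IsHurwitz (toC (A + B * F))

/-- `(C, A)` is detectable. -/
def Detectable (C : Matrix ρ σ ℝ) (A : Matrix σ σ ℝ) : Prop :=
  ∃ K : Matrix σ ρ ℝ, IsHurwitz (toC (A + K * C))

/-- `X` is a positive semidefinite stabilizing solution of the algebraic Riccati equation
`Aᵀ X + X A + Q - X B R⁻¹ Bᵀ X = 0`. -/
def IsStabilizingSolution (A : Matrix σ σ ℝ) (B : Matrix σ μ ℝ) (Q : Matrix σ σ ℝ)
    (R : Matrix μ μ ℝ) (X : Matrix σ σ ℝ) : Prop :=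
  X.PosSemidef ∧ Aᵀ * X + X * A + Q - X * B * R⁻¹ * Bᵀ * X = 0 ∧
    IsHurwitz (toC (A + B * (-(R⁻¹ * Bᵀ * X))))

open Classical in
/-- The stabilizing solution of the Riccati equation (`0` if there is none). -/
def ricSol (A : Matrix σ σ ℝ) (B : Matrix σ μ ℝ) (Q : Matrix σ σ ℝ) (R : Matrix μ μ ℝ) :
    Matrix σ σ ℝ :=
  if h : ∃ X, IsStabilizingSolution A B Q R X then h.choose else 0

/-- The optimal LQR gain `F = -R⁻¹ Bᵀ X`; the optimal policy is `u = F x`. -/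
def ric (A : Matrix σ σ ℝ) (B : Matrix σ μ ℝ) (Q : Matrix σ σ ℝ) (R : Matrix μ μ ℝ) :
    Matrix μ σ ℝ :=
  -(R⁻¹ * Bᵀ * ricSol A B Q R)

end LQR

/-! ### LTI systems and their feedback interconnection -/

/-- A (finite-dimensional) LTI system `x' = A x + B u`, `y = C x + D u` with state indexed by `σ`,
input by `μ` and output by `ρ`. Complex coefficients are allowed, so that in particular complex
constant gains (pure phase shifts) are LTI systems. -/
structure LTI (σ μ ρ : Type*) where
  A : Matrix σ σ ℂ
  B : Matrix σ μ ℂ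
  C : Matrix ρ σ ℂ
  D : Matrix ρ μ ℂ

namespace LTI

/-- The transfer matrix `C (s I - A)⁻¹ B + D`. -/
def transfer {σ μ ρ : Type*} [Fintype σ] [DecidableEq σ] (G : LTI σ μ ρ) (s : ℂ) :
    Matrix ρ μ ℂ :=
  G.C * (s • (1 : Matrix σ σ ℂ) - G.A)⁻¹ * G.B + G.D

/-- A stable LTI system. -/
def IsStable {σ μ ρ : Type*} [Fintype σ] [DecidableEq σ] (G : LTI σ μ ρ) : Prop :=
  IsHurwitz G.A

/-- The cascade `u ↦ G ↦ K ↦ y`, with transfer matrix `K(s) G(s)`. -/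
def cascade {σ τ μ ρ κ : Type*} [Fintype ρ] (G : LTI σ μ ρ) (K : LTI τ ρ κ) :
    LTI (σ ⊕ τ) μ κ where
  A := Matrix.fromBlocks G.A 0 (K.B * G.C) K.A
  B := Matrix.fromRows G.B (K.B * G.D)
  C := Matrix.fromCols (K.D * G.C) K.C
  D := K.D * G.D

/-- The block-diagonal LTI system `diag{G i}`. -/
def diag {ι : Type*} [DecidableEq ι] {σ μ ρ : ι → Type*} (G : ∀ i, LTI (σ i) (μ i) (ρ i)) :
    LTI (Σ i, σ i) (Σ i, μ i) (Σ i, ρ i) where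
  A := Matrix.blockDiagonal' fun i => (G i).A
  B := Matrix.blockDiagonal' fun i => (G i).B
  C := Matrix.blockDiagonal' fun i => (G i).C
  D := Matrix.blockDiagonal' fun i => (G i).D

section Feedback

variable {σ τ μ ρ : Type*} [Fintype σ] [DecidableEq σ] [Fintype τ] [DecidableEq τ]
  [Fintype μ] [DecidableEq μ] [Fintype ρ] [DecidableEq ρ]

/-- The algebraic part of the loop `u₁ = y₂`, `u₂ = y₁` of `G` (system 1) and `K` (system 2):
`(I, -D₂; -D₁, I) (u₁; u₂) = (C₂ x₂; C₁ x₁)`. -/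
def loopMatrix (G : LTI σ μ ρ) (K : LTI τ ρ μ) : Matrix (μ ⊕ ρ) (μ ⊕ ρ) ℂ :=
  Matrix.fromBlocks 1 (-K.D) (-G.D) 1

/-- The (positive) feedback interconnection of `G` and `K` is well-posed: the loop signals are
uniquely determined by the states. -/
def WellPosed (G : LTI σ μ ρ) (K : LTI τ ρ μ) : Prop :=
  IsUnit (loopMatrix G K)

/-- The state matrix of the (positive) feedback interconnection of `G` and `K`. -/
def closedLoop (G : LTI σ μ ρ) (K : LTI τ ρ μ) : Matrix (σ ⊕ τ) (σ ⊕ τ) ℂ :=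
  Matrix.fromBlocks G.A 0 0 K.A +
    Matrix.fromBlocks G.B 0 0 K.B * (loopMatrix G K)⁻¹ * Matrix.fromBlocks 0 K.C G.C 0

/-- Internal stability: all states of the interconnection decay, i.e. the closed-loop state
matrix is Hurwitz. -/
def InternallyStable (G : LTI σ μ ρ) (K : LTI τ ρ μ) : Prop :=
  IsHurwitz (closedLoop G K)

end Feedback

end LTI

/-! ### Block structure along a directed acyclic graph -/

section Graph

variable {ι : Type*} (G : Digraph ι)

/-- The graph has no directed cycle (in particular no self-loop). -/
def IsDAG : Prop := ∀ i, ¬ Relation.TransGen G.Adj i i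

/-- The descendants of `i`, including `i`. -/
def des (i : ι) : Set ι := {j | Relation.ReflTransGen G.Adj i j}

/-- The strict descendants of `i`. -/
def sdes (i : ι) : Set ι := {j | Relation.TransGen G.Adj i j}

instance (i j : ι) : Decidable (j ∈ des G i) := Classical.dec _

instance (i j : ι) : Decidable (j ∈ sdes G i) := Classical.dec _

/-- Coordinates of a vector partitioned into blocks of sizes `n i`. -/
abbrev Idx (n : ι → ℕ) := Σ i, Fin (n i)

/-- Coordinates in the blocks of the descendants of `i`. -/
abbrev DesIdx (n : ι → ℕ) (i : ι) := {p : Idx n // p.1 ∈ des G i}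

/-- Coordinates in the blocks of the strict descendants of `i`. -/
abbrev SDesIdx (n : ι → ℕ) (i : ι) := {p : Idx n // p.1 ∈ sdes G i}

/-- Block `(i, j)` of a block matrix. -/
def block {r c : ι → ℕ} (M : Matrix (Idx r) (Idx c) ℝ) (i j : ι) :
    Matrix (Fin (r i)) (Fin (c j)) ℝ :=
  Matrix.of fun a b => M ⟨i, a⟩ ⟨j, b⟩

/-- Off-diagonal blocks vanish. -/
def IsBlockDiag {r c : ι → ℕ} (M : Matrix (Idx r) (Idx c) ℝ) : Prop :=
  ∀ i j, i ≠ j → block M i j = 0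

/-- The block-sparsity pattern of `M` conforms to the transitive closure of the graph:
block `(i, j)` vanishes unless `i` is a descendant of `j`. -/
def Conforms {r c : ι → ℕ} (M : Matrix (Idx r) (Idx c) ℝ) : Prop :=
  ∀ i j, i ∉ des G j → block M i j = 0

/-- The submatrix of the block rows and columns of the descendants of `i`. -/
def desSub {r c : ι → ℕ} (M : Matrix (Idx r) (Idx c) ℝ) (i : ι) :
    Matrix (DesIdx G r i) (DesIdx G c i) ℝ :=
  M.submatrix Subtype.val Subtype.val

end Graph

/-! ### The optimal decentralized LQR controller -/

section Controller

variable {ι : Type*} [Fintype ι] [DecidableEq ι] (G : Digraph ι) {n m : ι → ℕ}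
  (A : Matrix (Idx n) (Idx n) ℝ) (B : Matrix (Idx n) (Idx m) ℝ)
  (Q : Matrix (Idx n) (Idx n) ℝ) (R : Matrix (Idx m) (Idx m) ℝ)

/-- The LQR gain `F i` of the subproblem on the descendants of `i`. -/
def gain (i : ι) : Matrix (DesIdx G m i) (DesIdx G n i) ℝ :=
  ric (desSub G A i) (desSub G B i) (desSub G Q i) (desSub G R i)

/-- Coordinates of `ξ = (ξ i)`, where `ξ i` lives on the descendants of `i`. -/
abbrev XiIdx (n : ι → ℕ) := Σ i, DesIdx G n i

/-- Coordinates of the memory `η = (η i)` of the controller, where `η i` is the part of `ξ i` on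
the strict descendants of `i`. -/
abbrev MemIdx (n : ι → ℕ) := Σ i, SDesIdx G n i

/-- Contribution of the plant state to `ξ`. The block `i` of `ξ i` is
`x i - ∑ (η j) i`, the sum being over the strict ancestors `j` of `i` (so that
`x i` is the sum of `(ξ j) i` over all ancestors `j` of `i`, including `i`). -/
def xiOfState : Matrix (XiIdx G n) (Idx n) ℝ :=
  Matrix.of fun p q => if p.2.1.1 = p.1 ∧ p.2.1 = q then 1 else 0

/-- Contribution of the controller memory to `ξ`: see `xiOfState` for the block `i` of `ξ i`; on
strict descendants of `i`, `ξ i` is `η i`. -/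
def xiOfMem : Matrix (XiIdx G n) (MemIdx G n) ℝ :=
  Matrix.of fun p q =>
    if p.2.1.1 = p.1 then (if p.2.1 = q.2.1 then -1 else 0)
    else (if p.1 = q.1 ∧ p.2.1 = q.2.1 then 1 else 0)

/-- The memory update: `(η i)'` consists of the strict-descendant blocks of
`(A_des(i) + B_des(i) F i) (ξ i)`. -/
def memOfXi : Matrix (MemIdx G n) (XiIdx G n) ℝ :=
  Matrix.of fun q p =>
    if q.1 = p.1 then
      (if h : q.2.1.1 ∈ des G p.1 then
        (desSub G A p.1 + desSub G B p.1 * gain G A B Q R p.1) ⟨q.2.1, h⟩ p.2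
      else 0)
    else 0

/-- The control policy: block `i` of `u` is the sum, over the ancestors `j` of `i`
(including `i`), of block `i` of `F j (ξ j)`. -/
def inputOfXi : Matrix (Idx m) (XiIdx G n) ℝ :=
  Matrix.of fun r p =>
    if h : r.1 ∈ des G p.1 then gain G A B Q R p.1 ⟨r, h⟩ p.2 else 0

/-- The plant `x' = A x + B u` with the state as output. -/
def plant : LTI (Idx n) (Idx m) (Idx n) where
  A := toC A
  B := toC B
  C := 1
  D := 0

/-- The optimal decentralized LQR controller, as a system from `x` to `u`. -/
def controller : LTI (MemIdx G n) (Idx n) (Idx m) where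
  A := toC (memOfXi G A B Q R * xiOfMem G)
  B := toC (memOfXi G A B Q R * xiOfState G)
  C := toC (inputOfXi G A B Q R * xiOfMem G)
  D := toC (inputOfXi G A B Q R * xiOfState G)

/-- The optimal loop gain: the plant followed by the optimal decentralized controller. -/
def loopGain : LTI (Idx n ⊕ MemIdx G n) (Idx m) (Idx m) :=
  (plant A B).cascade (controller G A B Q R)

end Controller

end DecLQR

end

/-! The loop gain has no direct feedthrough, which makes the loop well-posed. For stability, suppose
that the closed-loop matrix has an eigenvector (δ, x, η) with eigenvalue z, Re z ≥ 0, and show that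
it vanishes.

Proceed along the graph, by well-founded induction on strict ancestors. If all signals vanish at the
strict ancestors of i, then x_i = (ξ_i)_i and u_i = Δ_i(z) (F_i ξ_i)_i. The i-th row of the plant
and the controller's own equations for the rest of ξ_i combine into a single equation A_des ξ +
B_des u = z ξ, where u agrees with y = F_i ξ except in block i, where Δ_i(z) acts. This is a
centralized LQR loop on des(i), perturbed by diag(Δ_i, I, ..., I). As R is block-diagonal, the
inequality 2 Re y*Ru ≥ y*Ry splits over nodes: at i it is the hypothesis on Δ_i, elsewhere it reads
2R ≽ R.

For one LQR loop (`lqr_mode_eq_zero`), pairing the Riccati equation with ξ gives 2 Re(z) ξ*Xξ + ξ*Qξ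
+ (2 Re y*Ru - y*Ry) = 0, a sum of nonnegative terms. This forces y = 0, hence u = 0, so ξ is a mode
of the nominal stable loop and vanishes.

Two further ingredients are needed. The condition on Δ_i is given on the imaginary axis and is
carried to the right half-plane by a minimum principle (`LTI.le_re_transfer`). The stabilizing
Riccati solutions must exist, since otherwise the gains take a default value;
`exists_isStabilizingSolution` builds them by policy iteration on Lyapunov equations, and
stabilizability and detectability descend to des(i) by block triangularity. -/

noncomputable section

namespace DecLQR

/-! ### Eigenvectors, Hurwitz matrices and powers of Schur stable matrices. -/

section Spectral

variable {σ : Type*} [Fintype σ] [DecidableEq σ]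

theorem mem_spectrum_iff_exists_eigenvector {M : Matrix σ σ ℂ} {z : ℂ} :
    z ∈ spectrum ℂ M ↔ ∃ v : σ → ℂ, v ≠ 0 ∧ M *ᵥ v = z • v := by
  rw [← Matrix.spectrum_toLin', ← Module.End.hasEigenvalue_iff_mem_spectrum]
  constructor
  · intro h
    obtain ⟨v, hv⟩ := h.exists_hasEigenvector
    exact ⟨v, hv.2, by simpa using hv.apply_eq_smul⟩
  · rintro ⟨v, hv, h⟩
    exact Module.End.hasEigenvalue_of_hasEigenvector
      (Module.End.hasEigenvector_iff.2 ⟨Module.End.mem_eigenspace_iff.2 (by simpa using h), hv⟩)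

/-- The form in which stability is used and proved throughout: modes in the closed right half-plane
are trivial. -/
theorem isHurwitz_iff {M : Matrix σ σ ℂ} :
    IsHurwitz M ↔ ∀ (z : ℂ) (v : σ → ℂ), 0 ≤ z.re → M *ᵥ v = z • v → v = 0 := by
  constructor
  · intro h z v hz hv
    by_contra hne
    exact absurd (h z (mem_spectrum_iff_exists_eigenvector.2 ⟨v, hne, hv⟩)) (not_lt.2 hz)
  · intro h z hz
    obtain ⟨v, hne, hv⟩ := mem_spectrum_iff_exists_eigenvector.1 hz
    by_contra hlt
    exact hne (h z v (not_lt.1 hlt) hv)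

-- Gelfand's formula: a spectral radius below r < 1 bounds the norm of the k-th power by r ^ k for
-- large k.
open Matrix.Norms.Operator in
theorem tendsto_pow_zero_of_spectrum_lt_one {M : Matrix σ σ ℂ}
    (h : ∀ z ∈ spectrum ℂ M, ‖z‖ < 1) :
    Filter.Tendsto (fun k : ℕ => M ^ k) Filter.atTop (nhds 0) := by
  rcases isEmpty_or_nonempty σ with hσ | hσ
  · have : Subsingleton (Matrix σ σ ℂ) := inferInstance
    exact tendsto_const_nhds.congr fun k => Subsingleton.elim 0 _
  have hr : spectralRadius ℂ M < 1 := by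
    simpa using spectrum.spectralRadius_lt_of_forall_lt M (r := 1) (fun z hz => by
      simpa [← NNReal.coe_lt_coe] using h z hz)
  obtain ⟨r, hr1, hr2⟩ := ENNReal.lt_iff_exists_nnreal_btwn.1 hr
  have hev := (spectrum.pow_nnnorm_pow_one_div_tendsto_nhds_spectralRadius M).eventually_lt_const hr1
  have hr2' : (r : ℝ) < 1 := by exact_mod_cast hr2
  refine squeeze_zero_norm' (a := fun k : ℕ => (r : ℝ) ^ k) ?_
    (tendsto_pow_atTop_nhds_zero_of_lt_one r.coe_nonneg hr2')
  filter_upwards [hev, Filter.eventually_gt_atTop 0] with k hk hk0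
  have h1 : ((‖M ^ k‖₊ : ENNReal)) ≤ (r : ENNReal) ^ k := by
    have := ENNReal.rpow_le_rpow hk.le (Nat.cast_nonneg k : (0 : ℝ) ≤ k)
    rwa [← ENNReal.rpow_mul, one_div, inv_mul_cancel₀ (by positivity), ENNReal.rpow_one,
      ENNReal.rpow_natCast] at this
  have h2 : ‖M ^ k‖₊ ≤ r ^ k := by exact_mod_cast h1
  exact_mod_cast h2

end Spectral

/-! ### Passage from real to complex matrices. -/

section Complexification

variable {α β γ : Type*}

theorem toC_add (M N : Matrix α β ℝ) : toC (M + N) = toC M + toC N := by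
  ext; simp

theorem toC_sub (M N : Matrix α β ℝ) : toC (M - N) = toC M - toC N := by
  ext; simp

theorem toC_neg (M : Matrix α β ℝ) : toC (-M) = -toC M := by
  ext; simp

theorem toC_zero : toC (0 : Matrix α β ℝ) = 0 := by
  ext; simp

theorem toC_mul [Fintype β] (M : Matrix α β ℝ) (N : Matrix β γ ℝ) :
    toC (M * N) = toC M * toC N := by
  ext; simp [Matrix.mul_apply]

theorem toC_one [DecidableEq α] : toC (1 : Matrix α α ℝ) = 1 := by
  simp [toC]

theorem toC_pow [Fintype α] [DecidableEq α] (M : Matrix α α ℝ) (k : ℕ) :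
    toC (M ^ k) = toC M ^ k := by
  induction k with
  | zero => simp
  | succ k ih => rw [pow_succ, toC_mul, ih, pow_succ]

theorem toC_transpose (M : Matrix α β ℝ) : toC Mᵀ = (toC M)ᴴ := by
  ext; simp

open scoped MatrixOrder Matrix.Norms.L2Operator in
theorem exists_eq_transpose_mul_self [Fintype α] [DecidableEq α] {M : Matrix α α ℝ}
    (h : M.PosSemidef) : ∃ C : Matrix α α ℝ, M = Cᵀ * C := by
  obtain ⟨C, hC⟩ := CStarAlgebra.nonneg_iff_eq_star_mul_self.mp h.nonneg
  exact ⟨C, by rwa [Matrix.star_eq_conjTranspose,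
    Matrix.conjTranspose_eq_transpose_of_trivial] at hC⟩

theorem toC_posSemidef [Fintype α] [DecidableEq α] {M : Matrix α α ℝ} (h : M.PosSemidef) :
    (toC M).PosSemidef := by
  obtain ⟨C, rfl⟩ := exists_eq_transpose_mul_self h
  rw [toC_mul, toC_transpose]
  exact Matrix.posSemidef_conjTranspose_mul_self _

theorem toC_isUnit [Fintype α] [DecidableEq α] {M : Matrix α α ℝ} (h : IsUnit M) :
    IsUnit (toC M) :=
  h.map (Complex.ofRealHom.mapMatrix (m := α))

theorem toC_posDef [Fintype α] [DecidableEq α] {M : Matrix α α ℝ} (h : M.PosDef) :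
    (toC M).PosDef :=
  (toC_posSemidef h.posSemidef).posDef_iff_isUnit.2 (toC_isUnit h.isUnit)

end Complexification

/-! ### Lyapunov equations. -/

section Lyapunov

variable {σ : Type*} [Fintype σ] [DecidableEq σ]

/-- The Cayley transform turns a Hurwitz matrix into a Schur stable one. -/
theorem exists_cayley {A : Matrix σ σ ℝ} (hA : IsHurwitz (toC A)) :
    ∃ M : Matrix σ σ ℝ, IsUnit (1 - A) ∧ M * (1 - A) = 1 + A ∧
      Filter.Tendsto (fun k : ℕ => M ^ k) Filter.atTop (nhds 0) := by
  -- A kernel vector of 1 - A would be an eigenvector of A for the eigenvalue 1.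
  have hU : IsUnit (1 - A) := by
    have hinj : IsUnit (toC (1 - A)) := by
      rw [← Matrix.mulVec_injective_iff_isUnit]
      rw [← Matrix.coe_mulVecLin, ← LinearMap.ker_eq_bot, LinearMap.ker_eq_bot']
      intro v hv
      have h1 : toC A *ᵥ v = (1 : ℂ) • v := by
        rw [toC_sub, toC_one, Matrix.mulVecLin_apply, Matrix.sub_mulVec, Matrix.one_mulVec,
          sub_eq_zero] at hv
        rw [one_smul]; exact hv.symm
      exact isHurwitz_iff.1 hA 1 v (by simp) h1
    rw [Matrix.isUnit_iff_isUnit_det, isUnit_iff_ne_zero] at hinj ⊢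
    intro h0
    apply hinj
    have := (Complex.ofRealHom.map_det (1 - A)).symm
    rw [h0, map_zero] at this
    exact this
  have hUd := (Matrix.isUnit_iff_isUnit_det _).1 hU
  refine ⟨(1 + A) * (1 - A)⁻¹, hU, ?_, ?_⟩
  · rw [Matrix.mul_assoc, Matrix.nonsing_inv_mul _ hUd, Matrix.mul_one]
  set M := (1 + A) * (1 - A)⁻¹ with hM
  have hcomm : (1 - A) * M = 1 + A := by
    have : (1 - A) * (1 + A) = (1 + A) * (1 - A) := by noncomm_ring
    rw [hM, ← Matrix.mul_assoc, this, Matrix.mul_assoc, Matrix.mul_nonsing_inv _ hUd,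
      Matrix.mul_one]
  -- An eigenvalue z of M comes from the eigenvalue (z - 1)/(1 + z) of A, whose real part (|z|² -
  -- 1)/|1 + z|² is negative.
  have hspec : ∀ z ∈ spectrum ℂ (toC M), ‖z‖ < 1 := by
    intro z hz
    obtain ⟨v, hv0, hv⟩ := mem_spectrum_iff_exists_eigenvector.1 hz
    have h1 : toC (1 - A) *ᵥ (toC M *ᵥ v) = toC (1 + A) *ᵥ v := by
      rw [Matrix.mulVec_mulVec, ← toC_mul, hcomm]
    rw [hv, Matrix.mulVec_smul, toC_sub, toC_add, toC_one, Matrix.sub_mulVec, Matrix.add_mulVec,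
      Matrix.one_mulVec] at h1
    have h2 : (1 + z) • (toC A *ᵥ v) = (z - 1) • v := by
      have : z • v - z • (toC A *ᵥ v) = v + toC A *ᵥ v := by rw [← h1, smul_sub]
      rw [add_smul, one_smul, sub_smul, one_smul]
      rw [sub_eq_iff_eq_add.1 this]; abel
    have hz1 : 1 + z ≠ 0 := by
      intro h0
      rw [h0, zero_smul] at h2
      have h3 : z - 1 ≠ 0 := by
        intro h4
        have h5 : (2 : ℂ) = 0 := by linear_combination h0 - h4
        norm_num at h5
      exact hv0 ((smul_eq_zero.1 h2.symm).resolve_left h3)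
    have h3 : toC A *ᵥ v = ((z - 1) / (1 + z)) • v := by
      rw [div_eq_inv_mul, mul_smul, ← h2, smul_smul, inv_mul_cancel₀ hz1, one_smul]
    have h4 : ((z - 1) / (1 + z)).re < 0 := hA _ (mem_spectrum_iff_exists_eigenvector.2 ⟨v, hv0, h3⟩)
    have hpos : 0 < Complex.normSq (1 + z) := Complex.normSq_pos.2 hz1
    have h6 : ((z - 1) / (1 + z)).re = (Complex.normSq z - 1) / Complex.normSq (1 + z) := by
      rw [Complex.div_re, Complex.normSq_apply, Complex.normSq_apply]
      simp only [Complex.sub_re, Complex.add_re, Complex.sub_im, Complex.add_im, Complex.one_re,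
        Complex.one_im]
      rw [← add_div]
      congr 1
      ring
    rw [h6, div_lt_iff₀ hpos, zero_mul, Complex.normSq_eq_norm_sq] at h4
    nlinarith [norm_nonneg z]
  have hlim := tendsto_pow_zero_of_spectrum_lt_one hspec
  refine tendsto_pi_nhds.2 fun i => tendsto_pi_nhds.2 fun j => ?_
  have hi := tendsto_pi_nhds.1 hlim i
  rw [tendsto_pi_nhds] at hi
  have hj := (Complex.continuous_re.tendsto _).comp (hi j)
  have : (fun k : ℕ => (M ^ k) i j) = Complex.re ∘ fun k : ℕ => (toC M ^ k) i j := by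
    funext k
    simp [← toC_pow]
  rw [this]
  simpa using hj

/-- Under the Cayley transform the continuous-time Lyapunov operator becomes, up to congruence and a
factor, the discrete-time one. Powers of M then replace the matrix exponential and its integrals. -/
theorem lyapunov_cayley {A M X : Matrix σ σ ℝ} (hU : IsUnit (1 - A)) (hM : M * (1 - A) = 1 + A) :
    X - Mᵀ * X * M = ((1 - A)⁻¹)ᵀ * (-(2 : ℝ) • (Aᵀ * X + X * A)) * (1 - A)⁻¹ := by
  have hUd := (Matrix.isUnit_iff_isUnit_det _).1 hU
  have h1 : (1 - A) * (1 - A)⁻¹ = 1 := Matrix.mul_nonsing_inv _ hUd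
  have h2 : ((1 - A)⁻¹)ᵀ * (1 - A)ᵀ = 1 := by
    rw [← Matrix.transpose_mul, h1, Matrix.transpose_one]
  have h3 : (1 - A)ᵀ * (X - Mᵀ * X * M) * (1 - A) = -(2 : ℝ) • (Aᵀ * X + X * A) := by
    have : (1 - A)ᵀ * (X - Mᵀ * X * M) * (1 - A)
        = (1 - A)ᵀ * X * (1 - A) - (M * (1 - A))ᵀ * X * (M * (1 - A)) := by
      rw [Matrix.transpose_mul]; noncomm_ring
    rw [this, hM, Matrix.transpose_sub, Matrix.transpose_add, Matrix.transpose_one, neg_smul,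
      two_smul]
    noncomm_ring
  rw [← h3]
  calc X - Mᵀ * X * M
      = (((1 - A)⁻¹)ᵀ * (1 - A)ᵀ) * (X - Mᵀ * X * M) * ((1 - A) * (1 - A)⁻¹) := by
        rw [h1, h2]; simp
    _ = _ := by simp only [Matrix.mul_assoc]

/-- In discrete time X = MᵀXM; iterating, X equals (M ^ k)ᵀ X M ^ k, which tends to 0. -/
theorem eq_zero_of_lyapunov_eq_zero {A X : Matrix σ σ ℝ} (hA : IsHurwitz (toC A))
    (h : Aᵀ * X + X * A = 0) : X = 0 := by
  obtain ⟨M, hU, hM, hlim⟩ := exists_cayley hA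
  have h1 := lyapunov_cayley (X := X) hU hM
  rw [h, smul_zero, Matrix.mul_zero, Matrix.zero_mul, sub_eq_zero] at h1
  have h2 : ∀ k : ℕ, X = (M ^ k)ᵀ * X * M ^ k := by
    intro k
    induction k with
    | zero => simp
    | succ k ih =>
      rw [pow_succ, Matrix.transpose_mul]
      calc X = Mᵀ * X * M := h1
        _ = Mᵀ * ((M ^ k)ᵀ * X * M ^ k) * M := by rw [← ih]
        _ = _ := by simp only [Matrix.mul_assoc]
  have hc : Continuous fun P : Matrix σ σ ℝ => Pᵀ * X * P := by fun_prop
  have h3 := (hc.tendsto 0).comp hlim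
  have h4 : (fun P : Matrix σ σ ℝ => Pᵀ * X * P) ∘ (fun k : ℕ => M ^ k) = fun _ => X := by
    funext k; exact (h2 k).symm
  rw [h4] at h3
  simpa using tendsto_nhds_unique tendsto_const_nhds h3

/-- X - MᵀXM is positive semidefinite, and telescoping gives the same for X - (M ^ k)ᵀ X M ^ k,
whose limit is X. -/
theorem posSemidef_of_lyapunov {A X W : Matrix σ σ ℝ} (hA : IsHurwitz (toC A))
    (hX : X.IsHermitian) (hW : W.PosSemidef) (h : Aᵀ * X + X * A + W = 0) : X.PosSemidef := by
  obtain ⟨M, hU, hM, hlim⟩ := exists_cayley hA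
  have h1 := lyapunov_cayley (X := X) hU hM
  have hV : (X - Mᵀ * X * M).PosSemidef := by
    rw [h1, eq_neg_of_add_eq_zero_left h, smul_neg, neg_smul, neg_neg,
      ← Matrix.conjTranspose_eq_transpose_of_trivial]
    exact (hW.smul (by norm_num : (0 : ℝ) ≤ 2)).conjTranspose_mul_mul_same _
  have h2 : ∀ k : ℕ, (X - (M ^ k)ᵀ * X * M ^ k).PosSemidef := by
    intro k
    induction k with
    | zero => simpa using Matrix.PosSemidef.zero
    | succ k ih =>
      have : X - (M ^ (k + 1))ᵀ * X * M ^ (k + 1)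
          = (X - (M ^ k)ᵀ * X * M ^ k) + (M ^ k)ᴴ * (X - Mᵀ * X * M) * M ^ k := by
        rw [Matrix.conjTranspose_eq_transpose_of_trivial, pow_succ', Matrix.transpose_mul]
        noncomm_ring
      rw [this]
      exact ih.add (hV.conjTranspose_mul_mul_same _)
  refine Matrix.PosSemidef.of_dotProduct_mulVec_nonneg hX fun v => ?_
  have hc : Continuous fun P : Matrix σ σ ℝ => star v ⬝ᵥ (X - Pᵀ * X * P) *ᵥ v := by fun_prop
  have h3 := (hc.tendsto 0).comp hlim
  simp only [Matrix.transpose_zero, Matrix.zero_mul, sub_zero] at h3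
  exact ge_of_tendsto' h3 fun k => (h2 k).dotProduct_mulVec_nonneg v

/-- The Lyapunov operator is injective on a finite-dimensional space, hence surjective. By
uniqueness the solution equals its transpose. -/
theorem exists_lyapunov {A W : Matrix σ σ ℝ} (hA : IsHurwitz (toC A)) (hW : W.PosSemidef) :
    ∃ X : Matrix σ σ ℝ, X.PosSemidef ∧ Aᵀ * X + X * A + W = 0 := by
  let f : Matrix σ σ ℝ →ₗ[ℝ] Matrix σ σ ℝ :=
    { toFun := fun X => Aᵀ * X + X * A
      map_add' := fun X Y => by noncomm_ring
      map_smul' := fun c X => by simp }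
  have hinj : Function.Injective f := by
    rw [← LinearMap.ker_eq_bot, LinearMap.ker_eq_bot']
    exact fun X hX => eq_zero_of_lyapunov_eq_zero hA hX
  obtain ⟨X, hX⟩ := LinearMap.injective_iff_surjective.1 hinj (-W)
  have hX' : Aᵀ * X + X * A = -W := hX
  have hW' : Wᵀ = W := by
    have := hW.1.eq; rwa [Matrix.conjTranspose_eq_transpose_of_trivial] at this
  have hsym : Xᵀ = X := by
    apply hinj
    change Aᵀ * Xᵀ + Xᵀ * A = Aᵀ * X + X * A
    rw [hX']
    have := congrArg Matrix.transpose hX'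
    rw [Matrix.transpose_add, Matrix.transpose_mul, Matrix.transpose_mul, Matrix.transpose_transpose,
      Matrix.transpose_neg, hW'] at this
    rw [← this, add_comm]
  have hE : Aᵀ * X + X * A + W = 0 := by rw [hX']; simp
  refine ⟨X, posSemidef_of_lyapunov hA ?_ hW hE, hE⟩
  rw [Matrix.IsHermitian, Matrix.conjTranspose_eq_transpose_of_trivial, hsym]

omit [DecidableEq σ] in
/-- A right half-plane eigenvector is annihilated by the right-hand side of the Lyapunov
equation. -/
theorem mulVec_eq_zero_of_lyapunov {M P W : Matrix σ σ ℂ} (hP : P.PosSemidef) (hW : W.PosSemidef)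
    (h : Mᴴ * P + P * M + W = 0) {z : ℂ} {v : σ → ℂ} (hz : 0 ≤ z.re) (hv : M *ᵥ v = z • v) :
    W *ᵥ v = 0 := by
  rw [← hW.dotProduct_mulVec_zero_iff]
  have h1 : star v ⬝ᵥ (Mᴴ * P + P * M + W) *ᵥ v = 0 := by rw [h]; simp
  rw [Matrix.add_mulVec, Matrix.add_mulVec, ← Matrix.mulVec_mulVec, ← Matrix.mulVec_mulVec, hv,
    dotProduct_add, dotProduct_add, Matrix.dotProduct_mulVec (star v) Mᴴ, ← Matrix.star_mulVec, hv,
    Matrix.mulVec_smul, star_smul, smul_dotProduct, dotProduct_smul, ← add_smul] at h1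
  have hp := hP.dotProduct_mulVec_nonneg v
  have hw := hW.dotProduct_mulVec_nonneg v
  have hzz : star z + z = ((2 * z.re : ℝ) : ℂ) := by
    apply Complex.ext <;> simp; ring
  rw [hzz] at h1
  have h2 : 0 ≤ ((2 * z.re : ℝ) : ℂ) • (star v ⬝ᵥ P *ᵥ v) := by
    rw [smul_eq_mul]
    exact mul_nonneg (by exact_mod_cast (by linarith : 0 ≤ 2 * z.re)) hp
  exact le_antisymm (by rw [← h1]; exact le_add_of_nonneg_left h2) hw

end Lyapunov

/-! ### The algebraic Riccati equation. -/

section Riccati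

variable {σ μ : Type*} [Fintype σ] [DecidableEq σ] [Fintype μ] [DecidableEq μ]

omit [DecidableEq σ] in
theorem mulVec_eq_zero_of_add {P W : Matrix σ σ ℂ} (hP : P.PosSemidef) (hW : W.PosSemidef)
    {v : σ → ℂ} (h : (P + W) *ᵥ v = 0) : P *ᵥ v = 0 ∧ W *ᵥ v = 0 := by
  have h1 : star v ⬝ᵥ (P *ᵥ v) + star v ⬝ᵥ (W *ᵥ v) = 0 := by
    rw [← dotProduct_add, ← Matrix.add_mulVec, h, dotProduct_zero]
  rw [← hP.dotProduct_mulVec_zero_iff, ← hW.dotProduct_mulVec_zero_iff]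
  exact (add_eq_zero_iff_of_nonneg (hP.dotProduct_mulVec_nonneg v)
    (hW.dotProduct_mulVec_nonneg v)).1 h1

omit [Fintype σ] [DecidableEq σ] in
theorem transpose_eq_of_posSemidef {M : Matrix σ σ ℝ} (h : M.PosSemidef) : Mᵀ = M := by
  have := h.1.eq
  rwa [Matrix.conjTranspose_eq_transpose_of_trivial] at this

/-- `(Q, A)` has no unobservable mode in the closed right half-plane. -/
def NoUnstableHidden {ρ : Type*} (Q : Matrix ρ σ ℝ) (A : Matrix σ σ ℝ) : Prop :=
  ∀ (z : ℂ) (v : σ → ℂ), 0 ≤ z.re → toC A *ᵥ v = z • v → toC Q *ᵥ v = 0 → v = 0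

theorem Detectable.noUnstableHidden {ρ : Type*} [Fintype ρ] {Q : Matrix ρ σ ℝ}
    {A : Matrix σ σ ℝ} (h : Detectable Q A) : NoUnstableHidden Q A := by
  obtain ⟨K, hK⟩ := h
  intro z v hz hA hQ
  refine isHurwitz_iff.1 hK z v hz ?_
  rw [toC_add, toC_mul, Matrix.add_mulVec, ← Matrix.mulVec_mulVec, hQ, hA]
  simp

variable {A : Matrix σ σ ℝ} {B : Matrix σ μ ℝ} {Q : Matrix σ σ ℝ} {R : Matrix μ μ ℝ}

/-- A mode v with Re z ≥ 0 is killed by each summand of the Lyapunov right-hand side. Then Fv = 0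
makes v a mode of A itself, and Qv = 0 makes it hidden, so v = 0. -/
theorem isHurwitz_of_lyapunov (hQ : Q.PosSemidef) (hR : R.PosDef) (hdet : NoUnstableHidden Q A)
    {F : Matrix μ σ ℝ} {Y W : Matrix σ σ ℝ} (hY : Y.PosSemidef) (hW : W.PosSemidef)
    (h : (A + B * F)ᵀ * Y + Y * (A + B * F) + (Q + Fᵀ * R * F + W) = 0) :
    IsHurwitz (toC (A + B * F)) := by
  rw [isHurwitz_iff]
  intro z v hz hv
  have hF : (Fᵀ * R * F).PosSemidef := by
    rw [← Matrix.conjTranspose_eq_transpose_of_trivial]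
    exact hR.posSemidef.conjTranspose_mul_mul_same F
  have h' := congrArg toC h
  rw [toC_add, toC_add, toC_mul, toC_mul, toC_transpose, toC_zero] at h'
  have h1 := mulVec_eq_zero_of_lyapunov (toC_posSemidef hY)
    (toC_posSemidef ((hQ.add hF).add hW)) h' hz hv
  rw [toC_add] at h1
  have h2 := (mulVec_eq_zero_of_add (toC_posSemidef (hQ.add hF)) (toC_posSemidef hW) h1).1
  rw [toC_add] at h2
  obtain ⟨h3, h4⟩ := mulVec_eq_zero_of_add (toC_posSemidef hQ) (toC_posSemidef hF) h2
  have h5 : toC F *ᵥ v = 0 := by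
    by_contra hne
    have h6 := (toC_posDef hR).dotProduct_mulVec_pos hne
    rw [Matrix.star_mulVec, ← Matrix.dotProduct_mulVec, Matrix.mulVec_mulVec, Matrix.mulVec_mulVec,
      ← toC_transpose, ← toC_mul, ← toC_mul, h4, dotProduct_zero] at h6
    exact lt_irrefl _ h6
  refine hdet z v hz ?_ h3
  rwa [toC_add, toC_mul, Matrix.add_mulVec, ← Matrix.mulVec_mulVec, h5, Matrix.mulVec_zero,
    add_zero] at hv

omit [DecidableEq σ] in
/-- Completion of squares in the Lyapunov operator of a closed loop. -/
theorem closedLoop_completion {F F' : Matrix μ σ ℝ} {Y : Matrix σ σ ℝ} (hY : Yᵀ = Y)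
    (hR : R.PosDef) (hF' : F' = -(R⁻¹ * Bᵀ * Y)) :
    (A + B * F)ᵀ * Y + Y * (A + B * F) + Fᵀ * R * F =
      (A + B * F')ᵀ * Y + Y * (A + B * F') + F'ᵀ * R * F' + (F - F')ᵀ * R * (F - F') := by
  have hRd := (Matrix.isUnit_iff_isUnit_det _).1 hR.isUnit
  have hRt := transpose_eq_of_posSemidef hR.posSemidef
  have h1 : Bᵀ * Y = -(R * F') := by
    rw [hF', Matrix.mul_neg, neg_neg, Matrix.mul_assoc, ← Matrix.mul_assoc R,
      Matrix.mul_nonsing_inv _ hRd, Matrix.one_mul]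
  have h2 : Y * B = -(F'ᵀ * R) := by
    have := congrArg Matrix.transpose h1
    rwa [Matrix.transpose_mul, Matrix.transpose_neg, Matrix.transpose_mul,
      Matrix.transpose_transpose, hY, hRt] at this
  have h3 : ∀ K : Matrix μ σ ℝ, (A + B * K)ᵀ * Y + Y * (A + B * K) =
      Aᵀ * Y + Y * A - Kᵀ * (R * F') - F'ᵀ * R * K := by
    intro K
    rw [Matrix.transpose_add, Matrix.transpose_mul, Matrix.add_mul, Matrix.mul_add,
      Matrix.mul_assoc Kᵀ, h1, ← Matrix.mul_assoc Y, h2, Matrix.mul_neg, Matrix.neg_mul]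
    abel
  rw [h3, h3, Matrix.transpose_sub, Matrix.sub_mul, Matrix.sub_mul, Matrix.mul_sub, Matrix.mul_sub]
  simp only [Matrix.mul_assoc]
  abel

/-- An antitone sequence of positive semidefinite matrices converges. -/
theorem exists_tendsto_of_antitone {Y : ℕ → Matrix σ σ ℝ} (hY : ∀ k, (Y k).PosSemidef)
    (hmono : ∀ k, (Y k - Y (k + 1)).PosSemidef) :
    ∃ X : Matrix σ σ ℝ, X.PosSemidef ∧ Filter.Tendsto Y Filter.atTop (nhds X) := by
  have hq : ∀ v : σ → ℝ, ∃ l, Filter.Tendsto (fun k => v ⬝ᵥ (Y k) *ᵥ v) Filter.atTop (nhds l) := by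
    intro v
    have hanti : Antitone fun k => v ⬝ᵥ (Y k) *ᵥ v := antitone_nat_of_succ_le fun k => by
      have := (hmono k).dotProduct_mulVec_nonneg v
      rw [Matrix.sub_mulVec, dotProduct_sub, sub_nonneg] at this
      exact this
    exact ⟨_, tendsto_atTop_ciInf hanti ⟨0, by
      rintro _ ⟨k, rfl⟩
      exact (hY k).dotProduct_mulVec_nonneg v⟩⟩
  choose q hq using hq
  have hent : ∀ (k : ℕ) (i j : σ), Y k i j =
      ((Pi.single i 1 + Pi.single j 1 : σ → ℝ) ⬝ᵥ (Y k) *ᵥ (Pi.single i 1 + Pi.single j 1)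
        - (Pi.single i 1 : σ → ℝ) ⬝ᵥ (Y k) *ᵥ (Pi.single i 1)
        - (Pi.single j 1 : σ → ℝ) ⬝ᵥ (Y k) *ᵥ (Pi.single j 1)) / 2 := by
    intro k i j
    have hs : Y k j i = Y k i j := congrFun (congrFun (transpose_eq_of_posSemidef (hY k)) i) j
    -- Polarization: convergence of the quadratic forms gives convergence of the entries.
    simp only [Matrix.mulVec_add, add_dotProduct, dotProduct_add, Matrix.mulVec_single_one,
      single_dotProduct, one_mul, Matrix.col_apply]
    rw [hs]
    ring
  let X : Matrix σ σ ℝ := Matrix.of fun i j =>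
    (q (Pi.single i 1 + Pi.single j 1) - q (Pi.single i 1) - q (Pi.single j 1)) / 2
  have hX : Filter.Tendsto Y Filter.atTop (nhds X) := by
    refine tendsto_pi_nhds.2 fun i => tendsto_pi_nhds.2 fun j => ?_
    simp_rw [hent _ i j]
    exact (((hq _).sub (hq _)).sub (hq _)).div_const 2
  refine ⟨X, Matrix.PosSemidef.of_dotProduct_mulVec_nonneg ?_ fun v => ?_, hX⟩
  · rw [Matrix.IsHermitian, Matrix.conjTranspose_eq_transpose_of_trivial]
    have h1 : Filter.Tendsto (fun k => (Y k)ᵀ) Filter.atTop (nhds Xᵀ) :=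
      ((by fun_prop : Continuous fun P : Matrix σ σ ℝ => Pᵀ).tendsto X).comp hX
    simp_rw [transpose_eq_of_posSemidef (hY _)] at h1
    exact tendsto_nhds_unique h1 hX
  · have hc : Continuous fun P : Matrix σ σ ℝ => star v ⬝ᵥ P *ᵥ v := by fun_prop
    exact ge_of_tendsto' ((hc.tendsto X).comp hX) fun k => (hY k).dotProduct_mulVec_nonneg v

/-- Existence of the stabilizing solution of the algebraic Riccati equation, by Kleinman's policy
iteration. -/
theorem exists_isStabilizingSolution (hQ : Q.PosSemidef) (hR : R.PosDef)
    (hAB : Stabilizable A B) (hdet : NoUnstableHidden Q A) :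
    ∃ X, IsStabilizingSolution A B Q R X := by
  have hFR : ∀ F : Matrix μ σ ℝ, (Fᵀ * R * F).PosSemidef := fun F => by
    rw [← Matrix.conjTranspose_eq_transpose_of_trivial]
    exact hR.posSemidef.conjTranspose_mul_mul_same F
  have hex : ∀ F : {F : Matrix μ σ ℝ // IsHurwitz (toC (A + B * F))}, ∃ Y : Matrix σ σ ℝ,
      Y.PosSemidef ∧ (A + B * F.1)ᵀ * Y + Y * (A + B * F.1) + (Q + F.1ᵀ * R * F.1) = 0 :=
    fun F => exists_lyapunov F.2 (hQ.add (hFR _))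
  choose Y hY hYeq using hex
  -- The cost matrix of a gain F also certifies the improved gain F' = -R⁻¹BᵀY, with the surplus (F
  -- - F')ᵀR(F - F'). That surplus drives both the stability of F' and the decrease of the cost.
  have hcomp : ∀ F, (A + B * (-(R⁻¹ * Bᵀ * Y F)))ᵀ * Y F + Y F * (A + B * (-(R⁻¹ * Bᵀ * Y F))) +
      (Q + (-(R⁻¹ * Bᵀ * Y F))ᵀ * R * (-(R⁻¹ * Bᵀ * Y F)) +
        (F.1 - -(R⁻¹ * Bᵀ * Y F))ᵀ * R * (F.1 - -(R⁻¹ * Bᵀ * Y F))) = 0 := by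
    intro F
    have h1 := closedLoop_completion (A := A) (B := B) (F := F.1)
      (transpose_eq_of_posSemidef (hY F)) hR rfl
    have h2 : (A + B * F.1)ᵀ * Y F + Y F * (A + B * F.1) + F.1ᵀ * R * F.1 + Q = 0 := by
      rw [← hYeq F]; abel
    rw [← h2, h1]
    abel
  have hnext : ∀ F, IsHurwitz (toC (A + B * (-(R⁻¹ * Bᵀ * Y F)))) := fun F =>
    isHurwitz_of_lyapunov hQ hR hdet (hY F) (hFR _) (hcomp F)
  let next : {F : Matrix μ σ ℝ // IsHurwitz (toC (A + B * F))} →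
      {F : Matrix μ σ ℝ // IsHurwitz (toC (A + B * F))} := fun F => ⟨_, hnext F⟩
  have hmono : ∀ F, (Y F - Y (next F)).PosSemidef := by
    intro F
    refine posSemidef_of_lyapunov (hnext F) ((hY F).1.sub (hY _).1)
      (hFR (F.1 - -(R⁻¹ * Bᵀ * Y F))) ?_
    have h1 := hcomp F
    have h2 := hYeq (next F)
    rw [← sub_eq_zero.2 (h1.trans h2.symm), Matrix.mul_sub, Matrix.sub_mul]
    abel
  obtain ⟨F₀, hF₀⟩ := hAB
  let S : ℕ → {F : Matrix μ σ ℝ // IsHurwitz (toC (A + B * F))} := fun k => next^[k] ⟨F₀, hF₀⟩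
  have hS : ∀ k, S (k + 1) = next (S k) := fun k => Function.iterate_succ_apply' next k _
  obtain ⟨X, hX, hlim⟩ := exists_tendsto_of_antitone (Y := fun k => Y (S k)) (fun k => hY _)
    (fun k => by rw [hS]; exact hmono _)
  have hc : Continuous fun p : Matrix σ σ ℝ × Matrix σ σ ℝ =>
      (A + B * (-(R⁻¹ * Bᵀ * p.1)))ᵀ * p.2 + p.2 * (A + B * (-(R⁻¹ * Bᵀ * p.1))) +
        (Q + (-(R⁻¹ * Bᵀ * p.1))ᵀ * R * (-(R⁻¹ * Bᵀ * p.1))) := by fun_prop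
  -- The gain comes from one iterate and its cost is the next one; in the limit both are X.
  have hlim2 : Filter.Tendsto (fun k => (Y (S k), Y (S (k + 1)))) Filter.atTop (nhds (X, X)) :=
    hlim.prodMk_nhds (hlim.comp (Filter.tendsto_add_atTop_nat 1))
  have h1 := (hc.tendsto (X, X)).comp hlim2
  have hzero : ∀ k, (A + B * (-(R⁻¹ * Bᵀ * Y (S k))))ᵀ * Y (S (k + 1)) +
      Y (S (k + 1)) * (A + B * (-(R⁻¹ * Bᵀ * Y (S k)))) +
        (Q + (-(R⁻¹ * Bᵀ * Y (S k)))ᵀ * R * (-(R⁻¹ * Bᵀ * Y (S k)))) = 0 := by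
    intro k
    rw [hS]
    exact hYeq (next (S k))
  have hXeq := tendsto_nhds_unique (h1.congr hzero) tendsto_const_nhds
  simp only at hXeq
  refine ⟨X, hX, ?_, isHurwitz_of_lyapunov hQ hR hdet hX Matrix.PosSemidef.zero
    (by rw [add_zero]; exact hXeq)⟩
  have hRd := (Matrix.isUnit_iff_isUnit_det _).1 hR.isUnit
  -- Completing squares at F = 0 converts the closed-loop Lyapunov form into the Riccati form.
  have h2 := closedLoop_completion (A := A) (B := B) (F := 0) (transpose_eq_of_posSemidef hX) hR
    (rfl : -(R⁻¹ * Bᵀ * X) = _)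
  have h3 : (-(R⁻¹ * Bᵀ * X))ᵀ * R * (-(R⁻¹ * Bᵀ * X)) = X * B * R⁻¹ * Bᵀ * X := by
    have hRt := transpose_eq_of_posSemidef hR.posSemidef
    have h4 : X * (B * R⁻¹) * R = X * B := by
      rw [Matrix.mul_assoc, Matrix.mul_assoc, Matrix.nonsing_inv_mul _ hRd, Matrix.mul_one]
    rw [Matrix.transpose_neg, Matrix.transpose_mul, Matrix.transpose_mul, Matrix.transpose_transpose,
      Matrix.transpose_nonsing_inv, hRt, transpose_eq_of_posSemidef hX, Matrix.neg_mul,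
      Matrix.neg_mul, Matrix.mul_neg, neg_neg, h4]
    simp only [Matrix.mul_assoc]
  rw [← h3]
  generalize -(R⁻¹ * Bᵀ * X) = F at h2 hXeq ⊢
  simp only [Matrix.mul_zero, add_zero, Matrix.transpose_zero, Matrix.zero_mul, zero_sub,
    Matrix.transpose_neg, Matrix.neg_mul, Matrix.mul_neg, neg_neg] at h2
  rw [h2, ← hXeq]
  abel

end Riccati

/-! ### From the imaginary axis to the right half-plane. -/

section RightHalfPlane

/-- Minimum principle for the real part of a bounded analytic function on the right half-plane. -/
theorem le_re_of_le_re_imaginary_axis {h : ℂ → ℂ} {c M : ℝ}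
    (hd : DiffContOnCl ℂ h {z | 0 < z.re}) (hM : ∀ z : ℂ, 0 ≤ z.re → ‖h z‖ ≤ M)
    (hc : ∀ x : ℝ, c ≤ (h (x * Complex.I)).re) {z : ℂ} (hz : 0 ≤ z.re) : c ≤ (h z).re := by
  have hexp : ∀ w : ℂ, 0 ≤ w.re → ‖Complex.exp (-h w)‖ ≤ Real.exp M := by
    intro w hw
    rw [Complex.norm_exp, Real.exp_le_exp, Complex.neg_re]
    exact (neg_le_abs _).trans ((Complex.abs_re_le_norm _).trans (hM w hw))
  -- The modulus of exp(-h) is exp(-Re h), so a lower bound on Re h is an upper bound on a modulus,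
  -- to which Phragmén–Lindelöf applies. The function is bounded, so growth exponent 1 with
  -- coefficient 0 suffices.
  have key : ‖Complex.exp (-h z)‖ ≤ Real.exp (-c) := by
    refine PhragmenLindelof.right_half_plane_of_bounded_on_real
      (f := fun z => Complex.exp (-h z)) (Complex.differentiable_exp.comp_diffContOnCl hd.neg)
      ⟨1, by norm_num, 0, ?_⟩ ?_ ?_ hz
    · refine Asymptotics.IsBigO.of_bound (Real.exp M) ?_
      rw [Filter.eventually_inf_principal]
      refine Filter.Eventually.of_forall fun w hw => ?_
      simpa using hexp w (le_of_lt hw)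
    · refine ⟨Real.exp M, ?_⟩
      rw [Filter.eventually_map]
      filter_upwards [Filter.eventually_ge_atTop (0 : ℝ)] with x hx
      exact hexp x (by simpa using hx)
    · intro x
      rw [Complex.norm_exp, Real.exp_le_exp, Complex.neg_re, neg_le_neg_iff]
      exact hc x
  rw [Complex.norm_exp, Real.exp_le_exp, Complex.neg_re, neg_le_neg_iff] at key
  exact key

variable {σ : Type*} [Fintype σ] [DecidableEq σ]

open Matrix.Norms.Operator in
/-- A linear functional of the resolvent of a Hurwitz matrix satisfies the minimum principle on
the right half-plane. -/
theorem le_re_resolvent {A : Matrix σ σ ℂ} (hA : IsHurwitz A) (ℓ : Matrix σ σ ℂ →ₗ[ℂ] ℂ) {c : ℝ}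
    (hc : ∀ x : ℝ, c ≤ (ℓ ((Complex.I * x) • (1 : Matrix σ σ ℂ) - A)⁻¹).re) {z : ℂ}
    (hz : 0 ≤ z.re) : c ≤ (ℓ (z • (1 : Matrix σ σ ℂ) - A)⁻¹).re := by
  have hres : ∀ w : ℂ, (w • (1 : Matrix σ σ ℂ) - A)⁻¹ = resolvent A w := by
    intro w
    rw [Matrix.nonsing_inv_eq_ringInverse, resolvent, Algebra.algebraMap_eq_smul_one]
  have hmem : ∀ w : ℂ, 0 ≤ w.re → w ∈ resolventSet ℂ A := by
    intro w hw
    by_contra hn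
    exact absurd (hA w hn) (not_lt.2 hw)
  let L : Matrix σ σ ℂ →L[ℂ] ℂ := LinearMap.toContinuousLinearMap ℓ
  have hdiff : ∀ w : ℂ, 0 ≤ w.re → DifferentiableAt ℂ (fun w => L (resolvent A w)) w := by
    intro w hw
    exact L.differentiableAt.comp w
      (spectrum.hasDerivAt_resolvent_const_left (hmem w hw)).differentiableAt
  have hcont : ContinuousOn (fun w => L (resolvent A w)) {w : ℂ | 0 ≤ w.re} := fun w hw =>
    (hdiff w hw).continuousAt.continuousWithinAt
  have hcl : closure {w : ℂ | 0 < w.re} = {w : ℂ | 0 ≤ w.re} := Complex.closure_setOfPred_lt_re 0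
  have hclosed : IsClosed {w : ℂ | 0 ≤ w.re} := isClosed_le continuous_const Complex.continuous_re
  -- The resolvent decays at infinity, and what remains of the half-plane is compact.
  have hbdd : ∃ M : ℝ, ∀ w : ℂ, 0 ≤ w.re → ‖L (resolvent A w)‖ ≤ M := by
    have h0 : Filter.Tendsto (fun w => ‖L (resolvent A w)‖) (Bornology.cobounded ℂ) (nhds 0) := by
      have := (L.continuous.tendsto 0).comp (spectrum.resolvent_tendsto_cobounded (𝕜 := ℂ) A)
      simpa using this.norm
    have h1 := h0.eventually_le_const (zero_lt_one)
    obtain ⟨r, -, hr⟩ := (Filter.hasBasis_cobounded_norm (E := ℂ)).eventually_iff.1 h1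
    have hK : IsCompact ({w : ℂ | 0 ≤ w.re} ∩ Metric.closedBall 0 r) :=
      (isCompact_closedBall (0 : ℂ) r).inter_left hclosed
    obtain ⟨M, hM⟩ := hK.exists_bound_of_continuousOn (hcont.mono Set.inter_subset_left)
    refine ⟨max M 1, fun w hw => ?_⟩
    rcases le_total ‖w‖ r with h | h
    · exact (hM w ⟨hw, by simpa using h⟩).trans (le_max_left _ _)
    · exact (hr h).trans (le_max_right _ _)
  obtain ⟨M, hM⟩ := hbdd
  rw [hres]
  refine le_re_of_le_re_imaginary_axis (h := fun w => L (resolvent A w)) (M := M)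
    ⟨fun w hw => (hdiff w (le_of_lt hw)).differentiableWithinAt, by rwa [hcl]⟩ hM ?_ hz
  intro x
  have := hc x
  rw [hres, mul_comm] at this
  exact this

variable {μ ρ : Type*} [Fintype μ] [Fintype ρ]

/-- A lower bound for the real part of a sesquilinear form of a stable transfer matrix extends
from the imaginary axis to the closed right half-plane. -/
theorem LTI.le_re_transfer {G : LTI σ μ ρ} (hG : G.IsStable) (w : ρ → ℂ) (y : μ → ℂ) {c : ℝ}
    (hc : ∀ x : ℝ, c ≤ (w ⬝ᵥ G.transfer (Complex.I * x) *ᵥ y).re) {z : ℂ} (hz : 0 ≤ z.re) :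
    c ≤ (w ⬝ᵥ G.transfer z *ᵥ y).re := by
  let ℓ : Matrix σ σ ℂ →ₗ[ℂ] ℂ :=
    { toFun := fun N => w ⬝ᵥ (G.C * N * G.B) *ᵥ y
      map_add' := fun N P => by
        rw [Matrix.mul_add, Matrix.add_mul, Matrix.add_mulVec, dotProduct_add]
      map_smul' := fun a N => by
        simp [Matrix.smul_mulVec] }
  have hℓ : ∀ s : ℂ, (w ⬝ᵥ G.transfer s *ᵥ y).re =
      (ℓ (s • (1 : Matrix σ σ ℂ) - G.A)⁻¹).re + (w ⬝ᵥ G.D *ᵥ y).re := by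
    intro s
    rw [LTI.transfer, Matrix.add_mulVec, dotProduct_add, Complex.add_re]
    rfl
  -- The direct term is constant, so it only shifts the bound on the resolvent part.
  rw [hℓ, ← sub_le_iff_le_add]
  refine le_re_resolvent hG ℓ (fun x => ?_) hz
  rw [sub_le_iff_le_add, ← hℓ]
  exact hc x

omit [Fintype ρ] in
/-- State equations of a stable system at a complex frequency in the closed right half-plane. -/
theorem LTI.output_eq_transfer {G : LTI σ μ ρ} (hG : G.IsStable) {z : ℂ} (hz : 0 ≤ z.re)
    {δ : σ → ℂ} {y : μ → ℂ} (h : G.A *ᵥ δ + G.B *ᵥ y = z • δ) :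
    G.C *ᵥ δ + G.D *ᵥ y = G.transfer z *ᵥ y := by
  have hu : IsUnit (z • (1 : Matrix σ σ ℂ) - G.A) := by
    by_contra hn
    refine absurd (hG z ?_) (not_lt.2 hz)
    rw [spectrum.mem_iff, Algebra.algebraMap_eq_smul_one]
    exact hn
  have h1 : (z • (1 : Matrix σ σ ℂ) - G.A) *ᵥ δ = G.B *ᵥ y := by
    rw [Matrix.sub_mulVec, Matrix.smul_mulVec, Matrix.one_mulVec, ← h]
    abel
  have h2 : δ = (z • (1 : Matrix σ σ ℂ) - G.A)⁻¹ *ᵥ (G.B *ᵥ y) := by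
    rw [← h1, Matrix.mulVec_mulVec,
      Matrix.nonsing_inv_mul _ ((Matrix.isUnit_iff_isUnit_det _).1 hu), Matrix.one_mulVec]
  rw [LTI.transfer, Matrix.add_mulVec, ← Matrix.mulVec_mulVec, ← Matrix.mulVec_mulVec, ← h2]

end RightHalfPlane

/-! ### Robustness of a single LQR loop. -/

section Core

variable {σ μ : Type*} [Fintype σ] [DecidableEq σ] [Fintype μ] [DecidableEq μ]
  {A : Matrix σ σ ℝ} {B : Matrix σ μ ℝ} {Q : Matrix σ σ ℝ} {R : Matrix μ μ ℝ}

/-- Existence rules out the default value 0 in `ricSol`. Uniqueness is not needed, because the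
chosen solution itself serves as X. -/
theorem ric_eq_of_exists (h : ∃ X, IsStabilizingSolution A B Q R X) :
    ∃ X, IsStabilizingSolution A B Q R X ∧ ric A B Q R = -(R⁻¹ * Bᵀ * X) := by
  refine ⟨h.choose, h.choose_spec, ?_⟩
  rw [ric, ricSol, dif_pos h]

/-- The LQR loop has no mode in the closed right half-plane when the input `u` is related to the
commanded input `F ξ` by a perturbation that is passive in the metric given by `R`. -/
theorem lqr_mode_eq_zero (hQ : Q.PosSemidef) (hR : R.PosDef)
    (h : ∃ X, IsStabilizingSolution A B Q R X) {z : ℂ} (hz : 0 ≤ z.re) {ξ : σ → ℂ} {u y : μ → ℂ}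
    (hy : toC (ric A B Q R) *ᵥ ξ = y) (hξ : toC A *ᵥ ξ + toC B *ᵥ u = z • ξ)
    (hu : y = 0 → u = 0)
    (hle : (star y ⬝ᵥ toC R *ᵥ y).re ≤ 2 * (star y ⬝ᵥ toC R *ᵥ u).re)
    (hlt : z.re = 0 → y ≠ 0 → (star y ⬝ᵥ toC R *ᵥ y).re < 2 * (star y ⬝ᵥ toC R *ᵥ u).re) :
    ξ = 0 := by
  obtain ⟨X, ⟨hX, hric, hstab⟩, hF⟩ := ric_eq_of_exists h
  have hRd := (Matrix.isUnit_iff_isUnit_det _).1 hR.isUnit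
  suffices hy0 : y = 0 by
    refine isHurwitz_iff.1 hstab z ξ hz ?_
    rw [← hF, toC_add, toC_mul, Matrix.add_mulVec, ← Matrix.mulVec_mulVec, hy, hy0,
      Matrix.mulVec_zero, ← hξ, hu hy0, Matrix.mulVec_zero]
  have hRF : R * ric A B Q R = -(Bᵀ * X) := by
    rw [hF, Matrix.mul_neg, Matrix.mul_assoc, ← Matrix.mul_assoc R, Matrix.mul_nonsing_inv _ hRd,
      Matrix.one_mul]
  have hRy : toC R *ᵥ y = -(toC Bᵀ *ᵥ (toC X *ᵥ ξ)) := by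
    rw [← hy, Matrix.mulVec_mulVec, ← toC_mul, hRF, toC_neg, Matrix.neg_mulVec, toC_mul,
      Matrix.mulVec_mulVec]
  have hRH : (toC R)ᴴ = toC R := (toC_posDef hR).1.eq
  have hXH : (toC X)ᴴ = toC X := (toC_posSemidef hX).1.eq
  have hyRu : star y ⬝ᵥ toC R *ᵥ u = -(star ξ ⬝ᵥ toC X *ᵥ (toC B *ᵥ u)) := by
    have h1 : star y ⬝ᵥ toC R *ᵥ u = star (toC R *ᵥ y) ⬝ᵥ u := by
      rw [Matrix.star_mulVec, hRH, Matrix.dotProduct_mulVec]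
    rw [h1, hRy, star_neg, neg_dotProduct, Matrix.star_mulVec, toC_transpose,
      Matrix.conjTranspose_conjTranspose, Matrix.star_mulVec, hXH, ← Matrix.dotProduct_mulVec,
      ← Matrix.dotProduct_mulVec]
  have hyRy : star y ⬝ᵥ toC R *ᵥ y = star ξ ⬝ᵥ toC (X * B * R⁻¹ * Bᵀ * X) *ᵥ ξ := by
    have h1 : star y ⬝ᵥ toC R *ᵥ y = star ξ ⬝ᵥ toC ((ric A B Q R)ᵀ * (R * ric A B Q R)) *ᵥ ξ := by
      rw [toC_mul, toC_mul, toC_transpose, ← Matrix.mulVec_mulVec, ← Matrix.mulVec_mulVec, hy,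
        Matrix.dotProduct_mulVec (star ξ), ← Matrix.star_mulVec, hy]
    rw [h1, hRF, hF, Matrix.transpose_neg, Matrix.neg_mul, Matrix.mul_neg, neg_neg, Matrix.transpose_mul,
      Matrix.transpose_mul, Matrix.transpose_transpose, Matrix.transpose_nonsing_inv,
      transpose_eq_of_posSemidef hR.posSemidef, transpose_eq_of_posSemidef hX]
    simp only [Matrix.mul_assoc]
  set p := star ξ ⬝ᵥ toC X *ᵥ ξ with hp
  have hp0 := (toC_posSemidef hX).dotProduct_mulVec_nonneg ξ
  have hq0 := (toC_posSemidef hQ).dotProduct_mulVec_nonneg ξ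
  have hXA : star ξ ⬝ᵥ toC X *ᵥ (toC A *ᵥ ξ) = z * p + star y ⬝ᵥ toC R *ᵥ u := by
    rw [hyRu, eq_sub_of_add_eq hξ, Matrix.mulVec_sub, dotProduct_sub, Matrix.mulVec_smul,
      dotProduct_smul, smul_eq_mul, sub_eq_add_neg]
  have hAX : star ξ ⬝ᵥ toC (Aᵀ * X) *ᵥ ξ = star (star ξ ⬝ᵥ toC X *ᵥ (toC A *ᵥ ξ)) := by
    rw [← Matrix.star_dotProduct, Matrix.star_mulVec, Matrix.star_mulVec, hXH,
      ← Matrix.dotProduct_mulVec, ← Matrix.dotProduct_mulVec, Matrix.mulVec_mulVec, toC_mul,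
      toC_transpose]
  have hE : star ξ ⬝ᵥ toC (Aᵀ * X + X * A + Q - X * B * R⁻¹ * Bᵀ * X) *ᵥ ξ = 0 := by
    rw [hric, toC_zero, Matrix.zero_mulVec, dotProduct_zero]
  rw [toC_sub, toC_add, toC_add, Matrix.sub_mulVec, Matrix.add_mulVec, Matrix.add_mulVec,
    dotProduct_sub, dotProduct_add, dotProduct_add, ← hyRy, hAX, toC_mul X A,
    ← Matrix.mulVec_mulVec, hXA] at hE
  -- The real part is the dissipation identity 2 Re(z) p + ξ*Qξ + 2 Re y*Ru - y*Ry = 0.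
  have hEre := congrArg Complex.re hE
  have hp' := Complex.nonneg_iff.1 hp0
  have hq' := Complex.nonneg_iff.1 hq0
  have hpim : p.im = 0 := hp'.2.symm
  simp only [Complex.add_re, Complex.sub_re, Complex.star_def, Complex.conj_re, Complex.mul_re,
    Complex.zero_re, hpim, mul_zero, sub_zero] at hEre
  by_contra hne
  -- On the axis the strict inequality contradicts the identity. Inside the half-plane the weak one
  -- forces p = 0, hence Xξ = 0 and Ry = 0.
  rcases hz.eq_or_lt with h0 | hpos
  · have := hlt h0.symm hne
    rw [← h0] at hEre
    nlinarith [hq'.1]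
  · have hpr : p.re = 0 := by
      have : z.re * p.re ≤ 0 := by nlinarith [hq'.1]
      exact le_antisymm (nonpos_of_mul_nonpos_right this hpos) hp'.1
    have hpz : p = 0 := Complex.ext hpr hpim
    have hXξ : toC X *ᵥ ξ = 0 := ((toC_posSemidef hX).dotProduct_mulVec_zero_iff ξ).1 hpz
    rw [hXξ, Matrix.mulVec_zero, neg_zero] at hRy
    have := (toC_posDef hR).dotProduct_mulVec_pos hne
    rw [hRy, dotProduct_zero] at this
    exact lt_irrefl _ this

end Core

/-! ### Block structure along the graph. -/

section Blocks

variable {ι : Type*} [Fintype ι] {G : Digraph ι} {r c : ι → ℕ}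

theorem wellFounded_transGen (hG : IsDAG G) : WellFounded (Relation.TransGen G.Adj) :=
  haveI : Std.Irrefl (Relation.TransGen G.Adj) := ⟨hG⟩
  Finite.wellFounded_of_trans_of_irrefl _

omit [Fintype ι] in
theorem transGen_of_mem_des {i j : ι} (h : j ∈ des G i) (hne : j ≠ i) :
    Relation.TransGen G.Adj i j :=
  (Relation.reflTransGen_iff_eq_or_transGen.1 h).resolve_left hne

omit [Fintype ι] in
theorem not_mem_des_of_transGen (hG : IsDAG G) {i j : ι} (h : Relation.TransGen G.Adj j i) :
    j ∉ des G i := fun hd => hG j (h.trans_left hd)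

theorem toC_mulVec_apply (M : Matrix (Idx r) (Idx c) ℝ) (w : Idx c → ℂ) (i : ι) (a : Fin (r i)) :
    (toC M *ᵥ w) ⟨i, a⟩ = ∑ k, (toC (block M i k) *ᵥ fun b => w ⟨k, b⟩) a := by
  rw [Matrix.mulVec, dotProduct, Fintype.sum_sigma]
  rfl

theorem toC_mulVec_eq_diag_block {M : Matrix (Idx r) (Idx c) ℝ} {w : Idx c → ℂ} {i : ι}
    (h : ∀ k, k ≠ i → block M i k = 0 ∨ ∀ b, w ⟨k, b⟩ = 0) (a : Fin (r i)) :
    (toC M *ᵥ w) ⟨i, a⟩ = (toC (block M i i) *ᵥ fun b => w ⟨i, b⟩) a := by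
  rw [toC_mulVec_apply, Fintype.sum_eq_single i]
  intro k hk
  rcases h k hk with h | h
  · rw [h, toC_zero, Matrix.zero_mulVec]; rfl
  · have : (fun b => w ⟨k, b⟩) = 0 := funext h
    rw [this, Matrix.mulVec_zero]; rfl

theorem IsBlockDiag.mulVec_apply {M : Matrix (Idx r) (Idx c) ℝ} (hM : IsBlockDiag M)
    (w : Idx c → ℂ) (i : ι) (a : Fin (r i)) :
    (toC M *ᵥ w) ⟨i, a⟩ = (toC (block M i i) *ᵥ fun b => w ⟨i, b⟩) a :=
  toC_mulVec_eq_diag_block (fun k hk => Or.inl (hM i k hk.symm)) a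

/-- At a node whose strict ancestors carry no signal, a conforming matrix acts by its diagonal
block. -/
theorem Conforms.mulVec_apply {M : Matrix (Idx r) (Idx c) ℝ} (hM : Conforms G M)
    {w : Idx c → ℂ} {i : ι} (hw : ∀ k, Relation.TransGen G.Adj k i → ∀ b, w ⟨k, b⟩ = 0)
    (a : Fin (r i)) :
    (toC M *ᵥ w) ⟨i, a⟩ = (toC (block M i i) *ᵥ fun b => w ⟨i, b⟩) a := by
  refine toC_mulVec_eq_diag_block (fun k hk => ?_) a
  by_cases h : i ∈ des G k
  · exact Or.inr (hw k (transGen_of_mem_des h hk.symm))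
  · exact Or.inl (hM i k h)

/-- Extension by zero of a vector on the descendants of `i`. -/
def extend (i : ι) (v : DesIdx G c i → ℂ) : Idx c → ℂ := fun p =>
  if h : p.1 ∈ des G i then v ⟨p, h⟩ else 0

omit [Fintype ι] in
@[simp] theorem extend_val {i : ι} (v : DesIdx G c i → ℂ) (p : DesIdx G c i) :
    extend i v p.1 = v p := dif_pos p.2

omit [Fintype ι] in
theorem extend_of_mem {i : ι} (v : DesIdx G c i → ℂ) {p : Idx c} (h : p.1 ∈ des G i) :
    extend i v p = v ⟨p, h⟩ := dif_pos h

omit [Fintype ι] in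
theorem extend_of_not_mem {i : ι} (v : DesIdx G c i → ℂ) {p : Idx c} (h : p.1 ∉ des G i) :
    extend i v p = 0 := dif_neg h

theorem sum_mul_extend {i : ι} (f : Idx c → ℂ) (v : DesIdx G c i → ℂ) :
    ∑ p : Idx c, f p * extend i v p = ∑ p : DesIdx G c i, f p.1 * v p := by
  have h1 := Fintype.sum_subtype_add_sum_subtype (fun p : Idx c => p.1 ∈ des G i)
    (fun p => f p * extend i v p)
  rw [← h1]
  have h2 : ∑ p : {p : Idx c // ¬ p.1 ∈ des G i}, f p.1 * extend i v p.1 = 0 :=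
    Finset.sum_eq_zero fun p _ => by rw [extend_of_not_mem v p.2, mul_zero]
  rw [h2, add_zero]
  exact Finset.sum_congr rfl fun p _ => by rw [extend_val]

theorem desSub_mulVec (M : Matrix (Idx r) (Idx c) ℝ) {i : ι} (v : DesIdx G c i → ℂ)
    (p : DesIdx G r i) : (toC (desSub G M i) *ᵥ v) p = (toC M *ᵥ extend i v) p.1 :=
  (sum_mul_extend (fun q => (M p.1 q : ℂ)) v).symm

/-- Descendants of descendants of i are descendants of i, so the vectors supported on des(i) are
preserved. Modes of the submatrix are therefore modes of the full matrix. -/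
theorem Conforms.mulVec_extend {M : Matrix (Idx r) (Idx c) ℝ} (hM : Conforms G M) {i : ι}
    (v : DesIdx G c i → ℂ) : toC M *ᵥ extend i v = extend i (toC (desSub G M i) *ᵥ v) := by
  funext p
  by_cases hp : p.1 ∈ des G i
  · rw [extend_of_mem _ hp, desSub_mulVec]
  · rw [extend_of_not_mem _ hp]
    refine Finset.sum_eq_zero fun q _ => ?_
    by_cases hq : q.1 ∈ des G i
    · have h0 : block M p.1 q.1 = 0 := hM _ _ fun h => hp (Relation.ReflTransGen.trans hq h)
      have h1 : M p q = 0 := congrFun (congrFun h0 p.2) q.2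
      simp [h1]
    · rw [extend_of_not_mem _ hq, mul_zero]

omit [Fintype ι] in
theorem extend_smul {i : ι} (z : ℂ) (v : DesIdx G c i → ℂ) :
    extend i (z • v) = z • extend i v := by
  funext p
  by_cases hp : p.1 ∈ des G i
  · simp [extend_of_mem _ hp]
  · simp [extend_of_not_mem _ hp]

omit [Fintype ι] in
theorem eq_zero_of_extend_eq_zero {i : ι} {v : DesIdx G c i → ℂ} (h : extend i v = 0) : v = 0 := by
  funext p
  rw [← extend_val v p, h]; rfl

/-- Applied to R, this lets the inequality between commanded and actual inputs be checked node by
node. -/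
theorem sum_sum_block {i : ι} (f g : DesIdx G c i → ℂ) {M : Matrix (Idx c) (Idx c) ℝ}
    (hM : IsBlockDiag M) :
    star f ⬝ᵥ toC (desSub G M i) *ᵥ g = ∑ k, (star fun b => extend i f ⟨k, b⟩) ⬝ᵥ
      toC (block M k k) *ᵥ fun b => extend i g ⟨k, b⟩ := by
  have h1 : star f ⬝ᵥ toC (desSub G M i) *ᵥ g
      = ∑ p : DesIdx G c i, (toC M *ᵥ extend i g) p.1 * star f p := by
    rw [dotProduct]
    exact Finset.sum_congr rfl fun p _ => by rw [desSub_mulVec, mul_comm]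
  rw [h1, ← sum_mul_extend, Fintype.sum_sigma]
  refine Finset.sum_congr rfl fun k _ => ?_
  rw [dotProduct]
  refine Finset.sum_congr rfl fun a _ => ?_
  rw [hM.mulVec_apply, mul_comm]
  congr 1
  by_cases hk : k ∈ des G i
  · rw [extend_of_mem _ (p := ⟨k, a⟩) hk, Pi.star_apply, Pi.star_apply,
      extend_of_mem _ (p := ⟨k, a⟩) hk]
  · rw [extend_of_not_mem _ (p := ⟨k, a⟩) hk, Pi.star_apply,
      extend_of_not_mem _ (p := ⟨k, a⟩) hk, star_zero]

variable [DecidableEq ι]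

/-- A block-triangular matrix with Hurwitz diagonal blocks is Hurwitz. -/
theorem Conforms.isHurwitz (hG : IsDAG G) {M : Matrix (Idx c) (Idx c) ℝ} (hM : Conforms G M)
    (h : ∀ i, IsHurwitz (toC (block M i i))) : IsHurwitz (toC M) := by
  rw [isHurwitz_iff]
  intro z v hz hv
  have key : ∀ i b, v ⟨i, b⟩ = 0 := by
    intro i
    induction i using (wellFounded_transGen hG).induction with
    | _ i ih =>
      have h0 : (fun b => v ⟨i, b⟩) = 0 := by
        refine isHurwitz_iff.1 (h i) z _ hz ?_
        funext a
        rw [← hM.mulVec_apply ih, hv]; rfl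
      exact fun b => congrFun h0 b
  funext p
  exact key p.1 p.2

theorem Conforms.isHurwitz_desSub {M : Matrix (Idx c) (Idx c) ℝ} (hM : Conforms G M)
    (h : IsHurwitz (toC M)) (i : ι) : IsHurwitz (toC (desSub G M i)) := by
  rw [isHurwitz_iff]
  intro z v hz hv
  refine eq_zero_of_extend_eq_zero (isHurwitz_iff.1 h z _ hz ?_)
  rw [hM.mulVec_extend, hv, extend_smul]

/-- A hidden mode of the subproblem, extended by zero, has zero Q-cost; since Q is positive
semidefinite, Q annihilates it, although only the rows in des(i) were known to vanish. -/
theorem NoUnstableHidden.desSub {A Q : Matrix (Idx c) (Idx c) ℝ} (hA : Conforms G A)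
    (hQ : Q.PosSemidef) (h : NoUnstableHidden Q A) (i : ι) :
    NoUnstableHidden (desSub G Q i) (desSub G A i) := by
  intro z v hz hv hQv
  refine eq_zero_of_extend_eq_zero (h z _ hz ?_ ?_)
  · rw [hA.mulVec_extend, hv, extend_smul]
  · rw [← (toC_posSemidef hQ).dotProduct_mulVec_zero_iff, dotProduct]
    refine Finset.sum_eq_zero fun p _ => ?_
    by_cases hp : p.1 ∈ des G i
    · have := congrFun hQv ⟨p, hp⟩
      rw [desSub_mulVec] at this
      rw [this, Pi.zero_apply, mul_zero]
    · rw [Pi.star_apply, extend_of_not_mem _ hp, star_zero, zero_mul]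

/-- Stabilizing every node locally gives a block-diagonal gain K for which A + BK is
block-triangular with Hurwitz diagonal blocks; the restriction to des(i) inherits stability. -/
theorem stabilizable_desSub (hG : IsDAG G) {A : Matrix (Idx r) (Idx r) ℝ}
    {B : Matrix (Idx r) (Idx c) ℝ} (hA : Conforms G A) (hB : IsBlockDiag B)
    (hAB : ∀ i, Stabilizable (block A i i) (block B i i)) (i : ι) :
    Stabilizable (desSub G A i) (desSub G B i) := by
  choose F hF using hAB
  let K : Matrix (Idx c) (Idx r) ℝ := Matrix.blockDiagonal' F
  have hK : ∀ j k, block (B * K) j k = block B j j * block K j k := by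
    intro j k
    ext a b
    change ∑ q : Idx c, B ⟨j, a⟩ q * K q ⟨k, b⟩ = ∑ q, block B j j a q * block K j k q b
    rw [Fintype.sum_sigma, Fintype.sum_eq_single j]
    · rfl
    · intro l hl
      refine Finset.sum_eq_zero fun q _ => ?_
      have : B ⟨j, a⟩ ⟨l, q⟩ = 0 := congrFun (congrFun (hB j l hl.symm) a) q
      rw [this, zero_mul]
  have hKd : ∀ j, block K j j = F j := by
    intro j; ext a b; exact Matrix.blockDiagonal'_apply_eq F j a b
  have hKo : ∀ j k, j ≠ k → block K j k = 0 := by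
    intro j k hjk; ext a b; exact Matrix.blockDiagonal'_apply_ne F a b hjk
  have hM : Conforms G (A + B * K) := by
    intro j k hjk
    have h1 : block (A + B * K) j k = block A j k + block (B * K) j k := rfl
    have hne : j ≠ k := by rintro rfl; exact hjk Relation.ReflTransGen.refl
    rw [h1, hA j k hjk, hK, hKo j k hne, Matrix.mul_zero, add_zero]
  have hH : IsHurwitz (toC (A + B * K)) := by
    refine hM.isHurwitz hG fun j => ?_
    have h1 : block (A + B * K) j j = block A j j + block (B * K) j j := rfl
    rw [h1, hK, hKd]
    exact hF j
  refine ⟨desSub G K i, ?_⟩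
  -- Rows of B in des(i) involve only inputs in des(i), so restriction commutes with this product.
  have hsub : desSub G A i + desSub G B i * desSub G K i = desSub G (A + B * K) i := by
    ext p q
    change A p.1 q.1 + ∑ s : DesIdx G c i, B p.1 s.1 * K s.1 q.1
      = A p.1 q.1 + ∑ s : Idx c, B p.1 s * K s q.1
    congr 1
    rw [← Fintype.sum_subtype_add_sum_subtype (fun s : Idx c => s.1 ∈ des G i), left_eq_add]
    refine Finset.sum_eq_zero fun s _ => ?_
    have hne : p.1.1 ≠ s.1.1 := fun h => s.2 (h ▸ p.2)
    have : B p.1 s.1 = 0 := congrFun (congrFun (hB _ _ hne) p.1.2) s.1.2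
    rw [this, zero_mul]
  rw [hsub]
  exact hM.isHurwitz_desSub hH i

end Blocks

/-! ### Feedback with a strictly proper system. -/

namespace LTI

section ClosedLoop

variable {σ τ μ ρ : Type*} [Fintype σ] [DecidableEq σ] [Fintype τ] [DecidableEq τ]
  [Fintype μ] [DecidableEq μ] [Fintype ρ] [DecidableEq ρ]

-- Without feedthrough in `K` the loop matrix is block-unipotent and is inverted by a sign change.
omit [Fintype σ] [DecidableEq σ] [Fintype τ] [DecidableEq τ] in
theorem loopMatrix_inv (G : LTI σ μ ρ) {K : LTI τ ρ μ} (hD : K.D = 0) :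
    loopMatrix G K * Matrix.fromBlocks 1 0 G.D 1 = 1 := by
  rw [loopMatrix, hD, Matrix.fromBlocks_multiply, ← Matrix.fromBlocks_one]
  simp

omit [Fintype σ] [DecidableEq σ] [Fintype τ] [DecidableEq τ] in
theorem wellPosed_of_strictlyProper (G : LTI σ μ ρ) {K : LTI τ ρ μ} (hD : K.D = 0) :
    WellPosed G K :=
  IsUnit.of_mul_eq_one _ (loopMatrix_inv G hD)

omit [Fintype σ] [DecidableEq σ] [Fintype τ] [DecidableEq τ] in
/-- The state matrix of the loop when the second system is strictly proper. -/
theorem closedLoop_of_strictlyProper (G : LTI σ μ ρ) {K : LTI τ ρ μ} (hD : K.D = 0) :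
    closedLoop G K = Matrix.fromBlocks G.A (G.B * K.C) (K.B * G.C) (K.A + K.B * G.D * K.C) := by
  rw [closedLoop, Matrix.inv_eq_right_inv (loopMatrix_inv G hD), Matrix.fromBlocks_multiply,
    Matrix.fromBlocks_multiply, Matrix.fromBlocks_add]
  simp

end ClosedLoop

theorem blockDiagonal'_mulVec {ι : Type*} [Fintype ι] [DecidableEq ι] {r c : ι → Type*}
    [∀ i, Fintype (c i)] (M : ∀ i, Matrix (r i) (c i) ℂ) (v : (Σ i, c i) → ℂ) (i : ι) (a : r i) :
    (Matrix.blockDiagonal' M *ᵥ v) ⟨i, a⟩ = (M i *ᵥ fun b => v ⟨i, b⟩) a := by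
  rw [Matrix.mulVec, dotProduct, Fintype.sum_sigma, Fintype.sum_eq_single i]
  · exact Finset.sum_congr rfl fun b _ => by rw [Matrix.blockDiagonal'_apply_eq]
  · intro k hk
    exact Finset.sum_eq_zero fun b _ => by
      rw [Matrix.blockDiagonal'_apply_ne _ _ _ hk.symm, zero_mul]

end LTI

/-! ### The passivity condition on the perturbations. -/

section Perturbation

variable {σ μ : Type*} [Fintype σ] [DecidableEq σ] [Fintype μ] [DecidableEq μ]

omit [DecidableEq μ] in
theorem re_dotProduct_conjTranspose {R T : Matrix μ μ ℂ} (hR : Rᴴ = R) (v : μ → ℂ) :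
    (star v ⬝ᵥ (Tᴴ * R + R * T - R) *ᵥ v).re =
      2 * (star v ⬝ᵥ R *ᵥ (T *ᵥ v)).re - (star v ⬝ᵥ R *ᵥ v).re := by
  have h1 : star v ⬝ᵥ (Tᴴ * R) *ᵥ v = star (star v ⬝ᵥ R *ᵥ (T *ᵥ v)) := by
    rw [← Matrix.star_dotProduct, Matrix.star_mulVec, Matrix.star_mulVec, hR,
      ← Matrix.dotProduct_mulVec, ← Matrix.dotProduct_mulVec, Matrix.mulVec_mulVec]
  rw [Matrix.sub_mulVec, Matrix.add_mulVec, dotProduct_sub, dotProduct_add, h1, Complex.sub_re,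
    Complex.add_re, Complex.star_def, Complex.conj_re, Matrix.mulVec_mulVec]
  ring

variable {G : LTI σ μ μ} {R : Matrix μ μ ℂ}

omit [DecidableEq μ] in
theorem LTI.lt_re_of_imaginary_axis (hR : Rᴴ = R)
    (h : ∀ ω : ℝ, ((G.transfer (Complex.I * ω))ᴴ * R + R * G.transfer (Complex.I * ω) - R).PosDef)
    {z : ℂ} (hz : z.re = 0) {v : μ → ℂ} (hv : v ≠ 0) :
    (star v ⬝ᵥ R *ᵥ v).re < 2 * (star v ⬝ᵥ R *ᵥ (G.transfer z *ᵥ v)).re := by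
  have hzI : z = Complex.I * (z.im : ℂ) := by
    apply Complex.ext <;> simp [hz]
  have h1 := (Complex.pos_iff.1 ((h z.im).dotProduct_mulVec_pos hv)).1
  rw [← hzI, re_dotProduct_conjTranspose hR] at h1
  linarith

-- For fixed v the form v*RΔ(z)v is linear in the transfer matrix, so its real part obeys the
-- minimum principle. Only the weak inequality is carried over, which is enough off the axis.
omit [DecidableEq μ] in
theorem LTI.le_re_of_right_half_plane (hG : G.IsStable) (hR : Rᴴ = R)
    (h : ∀ ω : ℝ, ((G.transfer (Complex.I * ω))ᴴ * R + R * G.transfer (Complex.I * ω) - R).PosDef)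
    {z : ℂ} (hz : 0 ≤ z.re) (v : μ → ℂ) :
    (star v ⬝ᵥ R *ᵥ v).re ≤ 2 * (star v ⬝ᵥ R *ᵥ (G.transfer z *ᵥ v)).re := by
  have h1 := LTI.le_re_transfer hG (star v ᵥ* R) v (c := (star v ⬝ᵥ R *ᵥ v).re / 2)
    (fun x => by
      have h2 := (Complex.nonneg_iff.1 ((h x).posSemidef.dotProduct_mulVec_nonneg v)).1
      rw [re_dotProduct_conjTranspose hR] at h2
      rw [← Matrix.dotProduct_mulVec]
      linarith) hz
  rw [← Matrix.dotProduct_mulVec] at h1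
  linarith

end Perturbation

/-! ### The controller's signals and the modal equations of the loop. -/

section Controller

variable {ι : Type*} [Fintype ι] [DecidableEq ι] {G : Digraph ι} {n m : ι → ℕ}

/-- The signal `ξ` as a function of the plant state and the controller memory. -/
def xi (G : Digraph ι) (x : Idx n → ℂ) (η : MemIdx G n → ℂ) : XiIdx G n → ℂ :=
  toC (xiOfState G) *ᵥ x + toC (xiOfMem G) *ᵥ η

/-- The subtracted terms are memories of strict ancestors, which are assumed silent. -/
theorem xi_of_eq {x : Idx n → ℂ} {η : MemIdx G n → ℂ} {i : ι}
    (hη : ∀ k, Relation.TransGen G.Adj k i → ∀ q, η ⟨k, q⟩ = 0) (p : DesIdx G n i)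
    (hp : p.1.1 = i) : xi G x η ⟨i, p⟩ = x p.1 := by
  have h1 : (toC (xiOfMem G) *ᵥ η) ⟨i, p⟩ = 0 := by
    refine Finset.sum_eq_zero fun q _ => ?_
    by_cases hq : p.1 = q.2.1
    · have hk : Relation.TransGen G.Adj q.1 i := by
        have := q.2.2
        rw [← hq, hp] at this
        exact this
      rw [hη q.1 hk q.2, mul_zero]
    · simp [xiOfMem, hp, hq]
  have h2 : (toC (xiOfState G) *ᵥ x) ⟨i, p⟩ = x p.1 := by
    rw [Matrix.mulVec, dotProduct, Fintype.sum_eq_single p.1]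
    · simp [xiOfState, hp]
    · intro q hq
      simp [xiOfState, hq.symm]
  rw [xi, Pi.add_apply, h1, h2, add_zero]

theorem xi_of_ne {x : Idx n → ℂ} {η : MemIdx G n → ℂ} {i : ι} (p : DesIdx G n i)
    (hp : p.1.1 ≠ i) : xi G x η ⟨i, p⟩ = η ⟨i, ⟨p.1, transGen_of_mem_des p.2 hp⟩⟩ := by
  have h1 : (toC (xiOfMem G) *ᵥ η) ⟨i, p⟩ = η ⟨i, ⟨p.1, transGen_of_mem_des p.2 hp⟩⟩ := by
    rw [Matrix.mulVec, dotProduct,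
      Fintype.sum_eq_single (⟨i, ⟨p.1, transGen_of_mem_des p.2 hp⟩⟩ : MemIdx G n)]
    · simp [xiOfMem, hp]
    · rintro ⟨k, q⟩ hq
      have hne : ¬ (i = k ∧ p.1 = q.1) := by
        rintro ⟨rfl, h⟩
        exact hq (by rw [Sigma.mk.injEq]; exact ⟨rfl, heq_of_eq (Subtype.ext h.symm)⟩)
      simp [xiOfMem, hp, hne]
  have h2 : (toC (xiOfState G) *ᵥ x) ⟨i, p⟩ = 0 :=
    Finset.sum_eq_zero fun q _ => by simp [xiOfState, hp]
  rw [xi, Pi.add_apply, h1, h2, zero_add]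

variable {A : Matrix (Idx n) (Idx n) ℝ} {B : Matrix (Idx n) (Idx m) ℝ}
  {Q : Matrix (Idx n) (Idx n) ℝ} {R : Matrix (Idx m) (Idx m) ℝ}

theorem memOfXi_mulVec (ξ : XiIdx G n → ℂ) {i : ι} (p : DesIdx G n i) (hp : p.1.1 ≠ i) :
    (toC (memOfXi G A B Q R) *ᵥ ξ) ⟨i, ⟨p.1, transGen_of_mem_des p.2 hp⟩⟩ =
      (toC (desSub G A i + desSub G B i * gain G A B Q R i) *ᵥ fun q => ξ ⟨i, q⟩) p := by
  rw [Matrix.mulVec, dotProduct, Fintype.sum_sigma, Fintype.sum_eq_single i]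
  · refine Finset.sum_congr rfl fun q _ => ?_
    congr 1
    simp only [Matrix.map_apply, memOfXi, Matrix.of_apply, if_true]
    rw [dif_pos p.2]
  · intro k hk
    refine Finset.sum_eq_zero fun q _ => ?_
    simp [memOfXi, hk.symm]

theorem inputOfXi_mulVec {ξ : XiIdx G n → ℂ} {i : ι}
    (hξ : ∀ k, Relation.TransGen G.Adj k i → ∀ q, ξ ⟨k, q⟩ = 0) (a : Fin (m i)) :
    (toC (inputOfXi G A B Q R) *ᵥ ξ) ⟨i, a⟩ =
      (toC (gain G A B Q R i) *ᵥ fun q => ξ ⟨i, q⟩) ⟨⟨i, a⟩, Relation.ReflTransGen.refl⟩ := by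
  rw [Matrix.mulVec, dotProduct, Fintype.sum_sigma, Fintype.sum_eq_single i]
  · refine Finset.sum_congr rfl fun q _ => ?_
    congr 1
    have h : inputOfXi G A B Q R ⟨i, a⟩ ⟨i, q⟩ =
        gain G A B Q R i ⟨⟨i, a⟩, Relation.ReflTransGen.refl⟩ q :=
      dif_pos (Relation.ReflTransGen.refl : i ∈ des G i)
    exact congrArg Complex.ofReal h
  · intro k hk
    refine Finset.sum_eq_zero fun q _ => ?_
    by_cases h : i ∈ des G k
    · rw [hξ k (transGen_of_mem_des h hk.symm), mul_zero]
    · simp [inputOfXi, h]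

theorem controller_A : (controller G A B Q R).A =
    toC (memOfXi G A B Q R) * toC (xiOfMem (n := n) G) :=
  toC_mul (memOfXi G A B Q R) (xiOfMem G)

theorem controller_B : (controller G A B Q R).B =
    toC (memOfXi G A B Q R) * toC (xiOfState (n := n) G) :=
  toC_mul (memOfXi G A B Q R) (xiOfState G)

theorem controller_C : (controller G A B Q R).C =
    toC (inputOfXi G A B Q R) * toC (xiOfMem (n := n) G) :=
  toC_mul (inputOfXi G A B Q R) (xiOfMem G)

theorem controller_D : (controller G A B Q R).D =
    toC (inputOfXi G A B Q R) * toC (xiOfState (n := n) G) :=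
  toC_mul (inputOfXi G A B Q R) (xiOfState G)

/-- The loop gain is strictly proper. -/
theorem loopGain_D : (loopGain G A B Q R).D = 0 :=
  Matrix.mul_zero _

/-- Modal equations of the perturbed loop. -/
theorem mode_equations {d : ι → ℕ} {Δ : ∀ i, LTI (Fin (d i)) (Fin (m i)) (Fin (m i))} {z : ℂ}
    {δ : (Σ i, Fin (d i)) → ℂ} {x : Idx n → ℂ} {η : MemIdx G n → ℂ}
    (h : LTI.closedLoop (LTI.diag Δ) (loopGain G A B Q R) *ᵥ Sum.elim δ (Sum.elim x η) =
      z • Sum.elim δ (Sum.elim x η)) :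
    ∃ y u : Idx m → ℂ, y = toC (inputOfXi G A B Q R) *ᵥ xi G x η ∧
      u = (LTI.diag Δ).C *ᵥ δ + (LTI.diag Δ).D *ᵥ y ∧
      (LTI.diag Δ).A *ᵥ δ + (LTI.diag Δ).B *ᵥ y = z • δ ∧
      toC A *ᵥ x + toC B *ᵥ u = z • x ∧
      toC (memOfXi G A B Q R) *ᵥ xi G x η = z • η := by
  refine ⟨_, _, rfl, rfl, ?_⟩
  have hC : (loopGain G A B Q R).C *ᵥ Sum.elim x η =
      toC (inputOfXi G A B Q R) *ᵥ xi G x η := by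
    rw [loopGain, LTI.cascade, Matrix.fromCols_mulVec, Sum.elim_comp_inl, Sum.elim_comp_inr]
    simp only [plant, controller_C, controller_D]
    rw [Matrix.mul_one, xi, Matrix.mulVec_add, Matrix.mulVec_mulVec,
      Matrix.mulVec_mulVec]
  set y := toC (inputOfXi G A B Q R) *ᵥ xi G x η with hy
  set u := (LTI.diag Δ).C *ᵥ δ + (LTI.diag Δ).D *ᵥ y with hu
  rw [LTI.closedLoop_of_strictlyProper _ loopGain_D, Matrix.fromBlocks_mulVec] at h
  have hw : (z • Sum.elim δ (Sum.elim x η) : (Σ i, Fin (d i)) ⊕ (Idx n ⊕ MemIdx G n) → ℂ) =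
      Sum.elim (z • δ) (Sum.elim (z • x) (z • η)) := by
    funext s; rcases s with s | s | s <;> rfl
  rw [hw, Sum.elim_eq_iff] at h
  obtain ⟨h1, h2⟩ := h
  simp only [Sum.elim_comp_inl, Sum.elim_comp_inr] at h1 h2
  rw [← Matrix.mulVec_mulVec, hC] at h1
  have h3 : (loopGain G A B Q R).A *ᵥ Sum.elim x η + (loopGain G A B Q R).B *ᵥ u =
      Sum.elim (z • x) (z • η) := by
    rw [← h2, hu, Matrix.add_mulVec, ← Matrix.mulVec_mulVec, Matrix.mul_assoc,
      ← Matrix.mulVec_mulVec, ← Matrix.mulVec_mulVec, hC, Matrix.mulVec_add]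
    abel
  have h4 : Sum.elim (toC A *ᵥ x + toC B *ᵥ u)
      (toC (memOfXi G A B Q R) *ᵥ xi G x η) = Sum.elim (z • x) (z • η) := by
    rw [← h3]
    rw [loopGain, LTI.cascade, Matrix.fromBlocks_mulVec, Matrix.fromRows_mulVec, Sum.elim_comp_inl,
      Sum.elim_comp_inr]
    simp only [plant, controller_A, controller_B]
    rw [Matrix.mul_one, Matrix.mul_zero, xi]
    funext s
    rcases s with s | s <;> simp [Matrix.mulVec_add, Matrix.mulVec_mulVec]
  exact ⟨h1, Sum.elim_eq_iff.1 h4⟩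

end Controller

/-! ### The perturbed loop at one node. -/

section NodeLoop

variable {ι : Type*} [Fintype ι] [DecidableEq ι] {G : Digraph ι} {n m : ι → ℕ}
  {A : Matrix (Idx n) (Idx n) ℝ} {B : Matrix (Idx n) (Idx m) ℝ}
  {Q : Matrix (Idx n) (Idx n) ℝ} {R : Matrix (Idx m) (Idx m) ℝ}

/-- Replace the `i`-th block of a vector on the descendants of `i`. -/
def setHead (i : ι) (v : DesIdx G m i → ℂ) (w : Fin (m i) → ℂ) : DesIdx G m i → ℂ :=
  fun p => if h : p.1.1 = i then w (h ▸ p.1.2) else v p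

omit [Fintype ι] in
theorem extend_setHead_self {i : ι} (v : DesIdx G m i → ℂ) (w : Fin (m i) → ℂ) (b : Fin (m i)) :
    extend i (setHead i v w) ⟨i, b⟩ = w b := by
  rw [extend_of_mem _ (p := ⟨i, b⟩) (Relation.ReflTransGen.refl : i ∈ des G i), setHead, dif_pos rfl]

omit [Fintype ι] in
theorem extend_setHead_of_ne {i k : ι} (hk : k ≠ i) (v : DesIdx G m i → ℂ) (w : Fin (m i) → ℂ)
    (b : Fin (m k)) : extend i (setHead i v w) ⟨k, b⟩ = extend i v ⟨k, b⟩ := by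
  by_cases h : k ∈ des G i
  · rw [extend_of_mem _ (p := ⟨k, b⟩) h, extend_of_mem _ (p := ⟨k, b⟩) h, setHead, dif_neg hk]
  · rw [extend_of_not_mem _ (p := ⟨k, b⟩) h, extend_of_not_mem _ (p := ⟨k, b⟩) h]

omit [Fintype ι] [DecidableEq ι] in
theorem posDef_block (hR : R.PosDef) (i : ι) : (block R i i).PosDef :=
  hR.submatrix (e := fun a => (⟨i, a⟩ : Idx m)) fun _ _ h => eq_of_heq (Sigma.mk.inj h).2

/-- The LQR loop on the descendants of `i`, perturbed at the `i`-th input only, has no mode in the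
closed right half-plane. -/
theorem node_mode_eq_zero (hQ : Q.PosSemidef) (hR : R.PosDef) (hRdiag : IsBlockDiag R) {i : ι}
    (hric : ∃ X, IsStabilizingSolution (desSub G A i) (desSub G B i) (desSub G Q i)
      (desSub G R i) X)
    {σ : Type*} [Fintype σ] [DecidableEq σ] {D : LTI σ (Fin (m i)) (Fin (m i))} (hD : D.IsStable)
    (hDR : ∀ ω : ℝ, ((D.transfer (Complex.I * ω))ᴴ * toC (block R i i) +
      toC (block R i i) * D.transfer (Complex.I * ω) - toC (block R i i)).PosDef)
    {z : ℂ} (hz : 0 ≤ z.re) {ξ : DesIdx G n i → ℂ} {w : Fin (m i) → ℂ}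
    (hw : w = D.transfer z *ᵥ fun b =>
      (toC (gain G A B Q R i) *ᵥ ξ) ⟨⟨i, b⟩, Relation.ReflTransGen.refl⟩)
    (hξ : toC (desSub G A i) *ᵥ ξ +
      toC (desSub G B i) *ᵥ setHead i (toC (gain G A B Q R i) *ᵥ ξ) w = z • ξ) :
    ξ = 0 := by
  set y := toC (gain G A B Q R i) *ᵥ ξ with hy
  have hyi : (fun b => extend i y ⟨i, b⟩) = fun b => y ⟨⟨i, b⟩, Relation.ReflTransGen.refl⟩ :=
    funext fun b => extend_of_mem _ (p := ⟨i, b⟩) (Relation.ReflTransGen.refl : i ∈ des G i)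
  rw [← hyi] at hw
  have hRH : ∀ k, (toC (block R k k))ᴴ = toC (block R k k) := fun k =>
    (toC_posDef (posDef_block hR k)).1.eq
  set s : ι → ℝ := fun k => ((star fun b => extend i y ⟨k, b⟩) ⬝ᵥ
      toC (block R k k) *ᵥ fun b => extend i y ⟨k, b⟩).re with hs
  set t : ι → ℝ := fun k => ((star fun b => extend i y ⟨k, b⟩) ⬝ᵥ
      toC (block R k k) *ᵥ fun b => extend i (setHead i y w) ⟨k, b⟩).re with ht
  have hs0 : ∀ k, 0 ≤ s k := fun k =>
    (Complex.nonneg_iff.1 ((toC_posDef (posDef_block hR k)).posSemidef.dotProduct_mulVec_nonneg _)).1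
  have hS : (star y ⬝ᵥ toC (desSub G R i) *ᵥ y).re = ∑ k, s k := by
    rw [sum_sum_block y y hRdiag, Complex.re_sum]
  have hT : (star y ⬝ᵥ toC (desSub G R i) *ᵥ setHead i y w).re = ∑ k, t k := by
    rw [sum_sum_block y _ hRdiag, Complex.re_sum]
  have htne : ∀ k, k ≠ i → t k = s k := fun k hk => by
    simp only [hs, ht, extend_setHead_of_ne hk]
  have hti : t i = ((star fun b => extend i y ⟨i, b⟩) ⬝ᵥ
      toC (block R i i) *ᵥ (D.transfer z *ᵥ fun b => extend i y ⟨i, b⟩)).re := by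
    simp only [ht, extend_setHead_self]
    rw [← hw]
  -- Channel i uses the condition on the perturbation; the other channels are unperturbed, where s ≤
  -- 2s suffices.
  have hle : ∀ k, s k ≤ 2 * t k := by
    intro k
    by_cases hk : k = i
    · subst hk
      rw [hti]
      exact LTI.le_re_of_right_half_plane hD (hRH k) hDR hz _
    · rw [htne k hk]
      linarith [hs0 k]
  refine lqr_mode_eq_zero (R := desSub G R i) (hQ.submatrix _) (hR.submatrix Subtype.val_injective) hric hz hy.symm hξ
    ?_ ?_ ?_
  · intro h0
    have hw0 : w = 0 := by
      have : (fun b => extend i y ⟨i, b⟩) = 0 := by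
        rw [hyi, h0]; rfl
      rw [hw, this, Matrix.mulVec_zero]
    funext p
    rw [setHead, hw0, h0]
    split_ifs <;> rfl
  · rw [hS, hT, Finset.mul_sum]
    exact Finset.sum_le_sum fun k _ => hle k
  · intro hz0 hne
    rw [hS, hT, Finset.mul_sum]
    refine Finset.sum_lt_sum (fun k _ => hle k) ?_
    -- One block where y is nonzero makes the sum inequality strict, whether or not that block is
    -- perturbed.
    obtain ⟨p, hp⟩ := Function.ne_iff.1 hne
    have hk : (fun b => extend i y ⟨p.1.1, b⟩) ≠ 0 := by
      intro h0
      apply hp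
      have := congrFun h0 p.1.2
      rwa [extend_of_mem _ (p := ⟨p.1.1, p.1.2⟩) p.2] at this
    refine ⟨p.1.1, Finset.mem_univ _, ?_⟩
    generalize p.1.1 = k at hk
    by_cases hki : k = i
    · subst hki
      rw [hti]
      exact LTI.lt_re_of_imaginary_axis (hRH k) hDR hz0 hk
    · rw [htne k hki]
      have := (Complex.pos_iff.1 ((toC_posDef (posDef_block hR k)).dotProduct_mulVec_pos hk)).1
      change 0 < s k at this
      linarith

/-- A mode in the closed right half-plane that is not excited upstream of node `i` is not excited
at node `i`. -/
theorem mode_eq_zero_at_node (hG : IsDAG G) (hA : Conforms G A) (hQ : Q.PosSemidef)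
    (hR : R.PosDef) (hBdiag : IsBlockDiag B) (hRdiag : IsBlockDiag R) {i : ι}
    (hric : ∃ X, IsStabilizingSolution (desSub G A i) (desSub G B i) (desSub G Q i)
      (desSub G R i) X)
    {d : ι → ℕ} {Δ : ∀ i, LTI (Fin (d i)) (Fin (m i)) (Fin (m i))} (hΔ : (Δ i).IsStable)
    (hΔR : ∀ ω : ℝ, (((Δ i).transfer (Complex.I * ω))ᴴ * toC (block R i i) +
      toC (block R i i) * (Δ i).transfer (Complex.I * ω) - toC (block R i i)).PosDef)
    {z : ℂ} (hz : 0 ≤ z.re) {δ : (Σ i, Fin (d i)) → ℂ} {x : Idx n → ℂ} {η : MemIdx G n → ℂ}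
    {y u : Idx m → ℂ} (hy : y = toC (inputOfXi G A B Q R) *ᵥ xi G x η)
    (hu : u = (LTI.diag Δ).C *ᵥ δ + (LTI.diag Δ).D *ᵥ y)
    (hδ : (LTI.diag Δ).A *ᵥ δ + (LTI.diag Δ).B *ᵥ y = z • δ)
    (hx : toC A *ᵥ x + toC B *ᵥ u = z • x)
    (hη : toC (memOfXi G A B Q R) *ᵥ xi G x η = z • η)
    (hx0 : ∀ k, Relation.TransGen G.Adj k i → ∀ b, x ⟨k, b⟩ = 0)
    (hη0 : ∀ k, Relation.TransGen G.Adj k i → ∀ q, η ⟨k, q⟩ = 0)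
    (hξ0 : ∀ k, Relation.TransGen G.Adj k i → ∀ q, xi G x η ⟨k, q⟩ = 0) :
    (∀ q, xi G x η ⟨i, q⟩ = 0) ∧ ∀ a, δ ⟨i, a⟩ = 0 := by
  set ξ : DesIdx G n i → ℂ := fun q => xi G x η ⟨i, q⟩ with hξdef
  set yi : Fin (m i) → ℂ := fun b => y ⟨i, b⟩ with hyi
  set ui : Fin (m i) → ℂ := fun b => u ⟨i, b⟩ with hui
  set δi : Fin (d i) → ℂ := fun b => δ ⟨i, b⟩ with hδi
  have hyF : yi = fun b => (toC (gain G A B Q R i) *ᵥ ξ) ⟨⟨i, b⟩, Relation.ReflTransGen.refl⟩ := by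
    funext b
    rw [hyi, hy]
    exact inputOfXi_mulVec hξ0 b
  have hδeq : (Δ i).A *ᵥ δi + (Δ i).B *ᵥ yi = z • δi := by
    funext a
    have := congrFun hδ ⟨i, a⟩
    rw [Pi.add_apply, LTI.diag, LTI.blockDiagonal'_mulVec, LTI.blockDiagonal'_mulVec] at this
    exact this
  have hueq : ui = (Δ i).transfer z *ᵥ yi := by
    rw [← LTI.output_eq_transfer hΔ hz hδeq]
    funext a
    rw [hui, hu]
    simp only [Pi.add_apply]
    rw [LTI.diag, LTI.blockDiagonal'_mulVec, LTI.blockDiagonal'_mulVec]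
  have hξi : ∀ b, extend i ξ ⟨i, b⟩ = x ⟨i, b⟩ := by
    intro b
    rw [extend_of_mem _ (p := ⟨i, b⟩) (Relation.ReflTransGen.refl : i ∈ des G i)]
    exact xi_of_eq hη0 _ rfl
  have hξ : ξ = 0 := by
    refine node_mode_eq_zero hQ hR hRdiag hric hΔ hΔR hz (w := ui) (by rw [hueq, hyF]) ?_
    funext p
    rw [Pi.add_apply, desSub_mulVec, desSub_mulVec]
    -- The head row is the true plant, driven by the perturbed input; the remaining rows are the
    -- controller's model, driven by the commanded input.
    by_cases hp : p.1.1 = i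
    · obtain ⟨⟨k, a⟩, hk⟩ := p
      obtain rfl : k = i := hp
      have h1 := congrFun hx ⟨k, a⟩
      rw [Pi.add_apply, hA.mulVec_apply hx0, hBdiag.mulVec_apply] at h1
      rw [hA.mulVec_apply (fun j hj b => extend_of_not_mem _ (not_mem_des_of_transGen hG hj)),
        hBdiag.mulVec_apply]
      simp only [hξi, extend_setHead_self]
      rw [h1, Pi.smul_apply, Pi.smul_apply, hξdef]
      simp only
      rw [xi_of_eq hη0 _ rfl]
    · have h1 := congrFun hη ⟨i, ⟨p.1, transGen_of_mem_des p.2 hp⟩⟩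
      rw [memOfXi_mulVec _ _ hp, Pi.smul_apply, ← xi_of_ne (x := x) (η := η) p hp, toC_add, toC_mul,
        Matrix.add_mulVec, ← Matrix.mulVec_mulVec, Pi.add_apply, desSub_mulVec, desSub_mulVec] at h1
      rw [Pi.smul_apply, ← h1]
      congr 1
      obtain ⟨⟨k, a⟩, hk⟩ := p
      rw [hBdiag.mulVec_apply, hBdiag.mulVec_apply]
      simp only [extend_setHead_of_ne hp]
      rfl
  refine ⟨fun q => congrFun hξ q, fun a => ?_⟩
  -- With no input, the perturbation's state is a mode of its own Hurwitz matrix.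
  have hy0 : yi = 0 := by
    rw [hyF, hξ, Matrix.mulVec_zero]; rfl
  rw [hy0, Matrix.mulVec_zero, add_zero] at hδeq
  exact congrFun (isHurwitz_iff.1 hΔ z δi hz hδeq) a

end NodeLoop

end DecLQR

end

/-! ### The main theorem: induction over the graph. -/

theorem theorem1 {ι : Type*} [Fintype ι] [DecidableEq ι]
    (G : Digraph ι) (hG : DecLQR.IsDAG G) (n m : ι → ℕ)
    (A : Matrix (DecLQR.Idx n) (DecLQR.Idx n) ℝ) (B : Matrix (DecLQR.Idx n) (DecLQR.Idx m) ℝ)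
    (Q : Matrix (DecLQR.Idx n) (DecLQR.Idx n) ℝ) (R : Matrix (DecLQR.Idx m) (DecLQR.Idx m) ℝ)
    (hA : DecLQR.Conforms G A)
    (hAB : ∀ i, DecLQR.Stabilizable (DecLQR.block A i i) (DecLQR.block B i i))
    (hQA : DecLQR.Detectable Q A)
    (hQ : Q.PosSemidef) (hR : R.PosDef)
    (hBdiag : DecLQR.IsBlockDiag B) (hRdiag : DecLQR.IsBlockDiag R)
    (d : ι → ℕ) (Δ : ∀ i, DecLQR.LTI (Fin (d i)) (Fin (m i)) (Fin (m i)))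
    (hΔ : ∀ i, (Δ i).IsStable)
    (hΔR : ∀ (i : ι) (ω : ℝ),
      (((Δ i).transfer (Complex.I * ω))ᴴ * DecLQR.toC (DecLQR.block R i i)
        + DecLQR.toC (DecLQR.block R i i) * (Δ i).transfer (Complex.I * ω)
        - DecLQR.toC (DecLQR.block R i i)).PosDef) :
    (DecLQR.LTI.diag Δ).WellPosed (DecLQR.loopGain G A B Q R) ∧
      (DecLQR.LTI.diag Δ).InternallyStable (DecLQR.loopGain G A B Q R) := by
  refine ⟨DecLQR.LTI.wellPosed_of_strictlyProper _ DecLQR.loopGain_D, ?_⟩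
  rw [DecLQR.LTI.InternallyStable, DecLQR.isHurwitz_iff]
  intro z v hz hv
  obtain ⟨δ, x, η, rfl⟩ : ∃ δ x η, v = Sum.elim δ (Sum.elim x η) :=
    ⟨fun s => v (Sum.inl s), fun s => v (Sum.inr (Sum.inl s)), fun s => v (Sum.inr (Sum.inr s)), by
      funext s; rcases s with s | s | s <;> rfl⟩
  obtain ⟨y, u, hy, hu, hδ, hx, hη⟩ := DecLQR.mode_equations hv
  have hric : ∀ i, ∃ X, DecLQR.IsStabilizingSolution (DecLQR.desSub G A i) (DecLQR.desSub G B i)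
      (DecLQR.desSub G Q i) (DecLQR.desSub G R i) X := fun i =>
    DecLQR.exists_isStabilizingSolution (hQ.submatrix _) (hR.submatrix Subtype.val_injective)
      (DecLQR.stabilizable_desSub hG hA hBdiag hAB i) (hQA.noUnstableHidden.desSub hA hQ i)
  -- The state x_i and the memory η_i are read off from ξ_i, but for x_i only once the memories of
  -- the strict ancestors vanish; hence the induction carries all four signals.
  have key : ∀ i, (∀ q, DecLQR.xi G x η ⟨i, q⟩ = 0) ∧ (∀ a, δ ⟨i, a⟩ = 0) ∧
      (∀ b, x ⟨i, b⟩ = 0) ∧ ∀ q, η ⟨i, q⟩ = 0 := by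
    intro i
    induction i using (DecLQR.wellFounded_transGen hG).induction with
    | _ i ih =>
      have hη0 := fun k hk => (ih k hk).2.2.2
      obtain ⟨h1, h2⟩ := DecLQR.mode_eq_zero_at_node hG hA hQ hR hBdiag hRdiag (hric i) (hΔ i)
        (hΔR i) hz hy hu hδ hx hη (fun k hk => (ih k hk).2.2.1) hη0 (fun k hk => (ih k hk).1)
      refine ⟨h1, h2, fun b => ?_, fun q => ?_⟩
      · exact (DecLQR.xi_of_eq hη0 ⟨⟨i, b⟩, Relation.ReflTransGen.refl⟩ rfl).symm.trans (h1 _)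
      · have hne : q.1.1 ≠ i := fun h => hG i (by simpa [DecLQR.sdes, h] using q.2)
        exact (DecLQR.xi_of_ne (x := x) (η := η) ⟨q.1, Relation.TransGen.to_reflTransGen q.2⟩
          hne).symm.trans (h1 _)
  funext s
  rcases s with s | s | s
  · exact (key s.1).2.1 s.2
  · exact (key s.1).2.2.1 s.2
  · exact (key s.1).2.2.2 s.2
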